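/- Let $q\in\{0,1\}$ and let $L$ be a primary function, by which we mean the following. * $L$ is meromorphic in $\mathbb C$; it is entire if $q=0$, and its only pole is a simple pole at $x=1$ if $q=1$. It has no zeros in $\{\operatorname{Re}x>1\}$, and $(\log L)^{(n)}(x)=O(x^{-N})$ as $x\to+\infty$ along the real axis, for all integers $n,N\ge 0$. * There are entire functions $\mathbf G$ and $\Xi$ of order $1$ with $\Xi(x)=\mathbf G(x)^{-1}(x-1)^qL(x)$ and $\Xi(x)=\Xi(1-x)$. * All zeros $x_k$ of $\mathbf G$ (the trivial zeros of $L$) lie in $\{\operatorname{Re}x\le 0\}$. All zeros $\rho$ of $\Xi$ (the nontrivial zeros of $L$) lie in $\{0<\operatorname{Re}x<1\}$ and none of them is real. Zeros are counted with multiplicities. * $\mathbf G$ has a generalized Stirling expansion: there are constants such that, for $x\to+\infty$ along the real axis, $$-\log\mathbf G(x)\sim \tilde a_1x(\log x-1)+b_1x+\tilde a_0\log x+b_0+\sum_{n\ge1}a_{-n}x^{-n},$$ and this expansion may be differentiated term by term any number of times. Let $\mathscr Z(s,x)=\sum_\rho(x-\rho)^{-s}$ and $\mathbf Z(s,x)=\sum_k(x-x_k)^{-s}$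 for $\operatorname{Re}s>1$, where $x\in\mathbb C$ is such that $x-\rho\notin(-\infty,0]$ for all $\rho$, respectively $x-x_k\notin(-\infty,0]$ for all $k$, and powers have their principal values. Then these series converge absolutely, and for every such fixed $x$ the functions $\mathscr Z(\cdot,x)$ and $\mathbf Z(\cdot,x)$ continue meromorphically to all $s\in\mathbb C$, with no pole except possibly at $s=1$. For the continued functions the following holds. 1. If $x\in\mathbb C\setminus(-\infty,1]$, and $x-\rho\notin(-\infty,0]$ for all $\rho$ and $x-x_k\notin(-\infty,0]$ for all $k$, then for $\operatorname{Re}s<1$ $$\mathscr Z(s,x)=-\mathbf Z(s,x)+\frac{q}{(x-1)^s}+\frac{\sin\pi s}{\pi}\int_0^\infty\frac{L'}{L}(x+y)\,y^{-s}\,dy,$$ where the integral converges absolutely. 2. If $x>0$ (so that all the conditions $x-\rho\notin(-\infty,0]$ and $x-x_k\notin(-\infty,0]$ hold automatically), then for $0<\operatorname{Re}s<1$ $$\mathscr Z(s,x)=-\mathbf Z(s,x)+\frac{\sin\pi s}{\pi}\int_0^\infty\Bigl[\frac{L'}{L}(x+y)+\frac{q}{x+y-1}\Bigr]y^{-s}\,dy,$$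 where the integral converges absolutely. In particular, this holds at $x=1$, where the bracket is $\frac{L'}{L}(1+y)+\frac qy$. -/

import Mathlib

open Complex Filter Set MeasureTheory Asymptotics

/-- `f` is an entire function of order exactly `μ`: the order is the infimum of the exponents
`a ≥ 0` such that `|f z| ≤ exp (|z| ^ a)` for all `z` of sufficiently large modulus. -/
def IsEntireOfOrder (f : ℂ → ℂ) (μ : ℝ) : Prop :=
  Differentiable ℂ f ∧
    IsGLB {a : ℝ | 0 ≤ a ∧ ∀ᶠ z in Bornology.cobounded ℂ, ‖f z‖ ≤ Real.exp (‖z‖ ^ a)} μ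

/-- Generalized Stirling expansion, as `x → +∞` along the real axis, of minus the logarithm of `G`,
`- log G(x) ∼ A₁ x (log x - 1) + b₁ x + A₀ log x + b₀ + ∑_{n ≥ 1} aₙ x⁻ⁿ`,
which may be differentiated term by term any number of times.  Here `log G` is a holomorphic
logarithm of `G` on the half-plane `Re z > 0`, called `ℓ` below. -/
def HasStirlingExpansion (G : ℂ → ℂ) : Prop :=
  ∃ (ℓ : ℂ → ℂ) (A₁ b₁ A₀ b₀ : ℂ) (a : ℕ → ℂ),
    (∀ z : ℂ, 0 < z.re → AnalyticAt ℂ ℓ z ∧ exp (ℓ z) = G z) ∧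
    ∀ N m : ℕ,
      (fun t : ℝ => iteratedDeriv m
        (fun z : ℂ => -ℓ z - (A₁ * (z * (log z - 1)) + b₁ * z + A₀ * log z + b₀
          + ∑ n ∈ Finset.Icc 1 N, a n * z ^ (-(n : ℤ)))) (t : ℂ))
        =O[atTop] fun t : ℝ => t ^ (-((N : ℤ) + 1 + (m : ℤ)))

/-- `L` is a primary function with trivial factor `G`, completed function `Ξ`, and a pole of
order `q` at `1`.  The trivial zeros of `L` are the zeros of `G`, the nontrivial zeros of `L`
are the zeros of `Ξ`. -/
structure IsPrimaryFunction (L G Ξ : ℂ → ℂ) (q : ℕ) : Prop where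
  /-- `L` is holomorphic away from `1`. -/
  analytic_off : ∀ z : ℂ, z ≠ 1 → AnalyticAt ℂ L z
  /-- `L` is holomorphic at `1` (case `q = 0`) or has a simple pole there (case `q = 1`). -/
  pole : (q = 0 ∧ AnalyticAt ℂ L 1) ∨ (q = 1 ∧ meromorphicOrderAt L 1 = (-1 : ℤ))
  nonvanishing : ∀ z : ℂ, 1 < z.re → L z ≠ 0
  /-- `(log L)⁽ⁿ⁾(x)` decays faster than any power of `x` as `x → +∞`, for every `n ≥ 0`. -/
  log_decay : ∀ n N : ℕ,
    (fun t : ℝ => iteratedDeriv n (fun z : ℂ => log (L z)) (t : ℂ))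
      =O[atTop] fun t : ℝ => t ^ (-(N : ℤ))
  G_order : IsEntireOfOrder G 1
  Xi_order : IsEntireOfOrder Ξ 1
  /-- `Ξ(z) = G(z)⁻¹ (z - 1)^q L(z)`; both sides are multiplied by `G`, and the point `1`, where
  `L` may have its pole, is left to continuity. -/
  factorization : ∀ z : ℂ, z ≠ 1 → G z * Ξ z = (z - 1) ^ q * L z
  functional_equation : ∀ z : ℂ, Ξ z = Ξ (1 - z)
  trivial_zeros : ∀ z : ℂ, G z = 0 → z.re ≤ 0
  /-- The nontrivial zeros lie in the open critical strip and none of them is real. -/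
  nontrivial_zeros : ∀ z : ℂ, Ξ z = 0 → 0 < z.re ∧ z.re < 1 ∧ z.im ≠ 0
  stirling : HasStirlingExpansion G

/-- The parameter `x` is eligible for the zeta function over the zeros of `f`:
`x - ρ` avoids `(-∞, 0]` for every zero `ρ`. -/
def IsEligible (f : ℂ → ℂ) (x : ℂ) : Prop :=
  ∀ ρ : ℂ, f ρ = 0 → x - ρ ∈ slitPlane

/-- `Z` is the zeta function `s ↦ ∑_ρ (x - ρ)^(-s)` over the zeros `ρ` of the entire function `f`,
counted with multiplicities: the series converges absolutely to `Z s` for `Re s > 1`, and `Z` is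
the meromorphic continuation of its sum to the whole plane, with no pole except possibly at
`s = 1`.  By the identity theorem these properties determine `Z` at every `s ≠ 1`. -/
structure IsZetaOverZeros (f : ℂ → ℂ) (x : ℂ) (Z : ℂ → ℂ) : Prop where
  hasSum : ∀ s : ℂ, 1 < s.re →
    HasSum (fun ρ : {z : ℂ // f z = 0} =>
      (analyticOrderNatAt f (ρ : ℂ) : ℂ) * (x - (ρ : ℂ)) ^ (-s)) (Z s)
  analytic : ∀ s : ℂ, s ≠ 1 → AnalyticAt ℂ Z s
  meromorphic : MeromorphicAt Z 1

/-!
For an entire function `f` of order one whose zeros `ρ` satisfy `Re ρ ≤ 1`, put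
`F = -(f' / f)'`.  The proof rests on three facts.

* `F z = ∑ (z - ρ)⁻²` (`IsEntireOfOrder.hasSum_deriv_logDeriv`).  Dividing `f` by its zeros in the
  disc of radius `R` leaves a zero-free function `g`, and the maximum principle on the disc of
  radius `3 R` bounds both `g` and the number of zeros.  Borel-Carathéodory and Cauchy's estimate
  then give `(log g)'' = O(R ^ (a - 2))` with `a < 2`, so the remainder vanishes in the limit; no
  canonical product is needed.  The zero count also yields absolute convergence for `Re s > 1`.

* For `1 < Re s < 2`, termwise integration with Euler's beta integral gives
  `(1 - s) ∑ (x - ρ) ^ (-s) = sin (π s) / π * ∫₀^∞ F (x + y) y ^ (1 - s) dy`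
  (`IsEntireOfOrder.one_sub_mul_tsum_eq`).  If `F (x + y)` has an asymptotic expansion in powers of
  `y⁻¹`, the Mellin transform continues with simple poles at integers, which the sine cancels.
  So `(1 - s) Z(s, x)` is entire (`IsEntireOfOrder.exists_isEntireZeta`).

* The hypotheses give expansions on the real axis only, but together with all derivatives.  As `F`
  is bounded on discs of radius `t / 4` about real `t`, Taylor's formula about `t` carries the
  expansions to every horizontal ray (`isBigO_shift`).  This applies to `G` through the
  Stirling expansion, to `L' / L` and its derivative, which decay rapidly, and hence to `Ξ`,
  because `L' / L = G' / G + Ξ' / Ξ - q / (z - 1)`.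

Adding the integral representations for `Ξ` and `G` in the strip `1 < Re s < 2` produces the Mellin
transform of `-(L' / L)' + q / (z - 1)²`.  Both sides continue to `Re s < 2` by the identity theorem
(to `0 < Re s < 2` when the pole is kept inside the integrand), and one integration by parts yields
the formulas for `Re s < 1`.
-/

/-! ### Dividing out zeros -/

/-- One zero of an entire function can be divided out completely. -/
lemma exists_entire_eq_pow_mul {f : ℂ → ℂ} (hf : Differentiable ℂ f) {ρ : ℂ}
    (hρ : analyticOrderAt f ρ ≠ ⊤) :
    ∃ g : ℂ → ℂ, Differentiable ℂ g ∧ g ρ ≠ 0 ∧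
      ∀ z, f z = (z - ρ) ^ analyticOrderNatAt f ρ * g z := by
  obtain ⟨g₀, hg₀, hne, hev⟩ := ((hf.analyticAt ρ).analyticOrderNatAt_eq_iff hρ).1 rfl
  set m := analyticOrderNatAt f ρ
  refine ⟨Function.update (fun z => f z / (z - ρ) ^ m) ρ (g₀ ρ), fun z => ?_, by simpa using hne,
    fun z => ?_⟩
  · rcases eq_or_ne z ρ with rfl | hz
    · refine hg₀.differentiableAt.congr_of_eventuallyEq ?_
      filter_upwards [hev] with w hw
      rcases eq_or_ne w z with rfl | hwz
      · simp
      · have : (w - z) ^ m ≠ 0 := pow_ne_zero _ (sub_ne_zero.2 hwz)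
        rw [Function.update_of_ne hwz, hw, smul_eq_mul]
        field_simp
    · have hd : DifferentiableAt ℂ (fun w => f w / (w - ρ) ^ m) z :=
        (hf z).div (by fun_prop) (pow_ne_zero _ (sub_ne_zero.2 hz))
      refine hd.congr_of_eventuallyEq ?_
      filter_upwards [isOpen_ne.mem_nhds hz] with w hw
      rw [Function.update_of_ne hw]
  · rcases eq_or_ne z ρ with rfl | hz
    · simpa using hev.self_of_nhds
    · have : (z - ρ) ^ m ≠ 0 := pow_ne_zero _ (sub_ne_zero.2 hz)
      rw [Function.update_of_ne hz]
      field_simp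

/-- An entire function with `f c ≠ 0` has finite order of vanishing everywhere. -/
lemma analyticOrderAt_ne_top_of_entire {f : ℂ → ℂ} (hf : Differentiable ℂ f) {c : ℂ}
    (hc : f c ≠ 0) (z : ℂ) : analyticOrderAt f z ≠ ⊤ := by
  refine AnalyticOnNhd.analyticOrderAt_ne_top_of_isPreconnected (U := univ) (x := c)
    (fun w _ => hf.analyticAt w) isPreconnected_univ (mem_univ _) (mem_univ _) ?_
  rw [((hf.analyticAt c).analyticOrderAt_eq_zero).2 hc]
  simp

/-- Finitely many zeros of an entire function can be divided out completely; the quotient is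
normalized so that it agrees with `f` at `c`. -/
lemma exists_entire_eq_prod_mul {f : ℂ → ℂ} (hf : Differentiable ℂ f) {c : ℂ} (hc : f c ≠ 0)
    (S : Finset ℂ) (hS : ∀ ρ ∈ S, f ρ = 0) :
    ∃ g : ℂ → ℂ, Differentiable ℂ g ∧ (∀ ρ ∈ S, g ρ ≠ 0) ∧
      ∀ z, f z = (∏ ρ ∈ S, ((z - ρ) / (c - ρ)) ^ analyticOrderNatAt f ρ) * g z := by
  classical
  induction S using Finset.induction_on with
  | empty => exact ⟨f, hf, by simp, by simp⟩
  | insert ρ S hρ ih =>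
    obtain ⟨g, hg, hgS, hfg⟩ := ih fun w hw => hS w (Finset.mem_insert_of_mem hw)
    have hcρ : c - ρ ≠ 0 := sub_ne_zero.2 fun h => hc (h ▸ hS ρ (Finset.mem_insert_self _ _))
    have hgc : g c ≠ 0 := fun h => hc (by rw [hfg c, h, mul_zero])
    obtain ⟨k, hk, hkρ, hgk⟩ := exists_entire_eq_pow_mul hg
      (analyticOrderAt_ne_top_of_entire hg hgc ρ)
    -- the factors already extracted do not vanish at `ρ`, so `f` and `g` vanish there equally
    have hord : analyticOrderNatAt f ρ = analyticOrderNatAt g ρ := by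
      have hP : AnalyticAt ℂ
          (fun z => ∏ w ∈ S, ((z - w) / (c - w)) ^ analyticOrderNatAt f w) ρ := by
        apply Differentiable.analyticAt
        fun_prop
      have hP0 : (∏ w ∈ S, ((ρ - w) / (c - w)) ^ analyticOrderNatAt f w) ≠ 0 := by
        refine Finset.prod_ne_zero_iff.2 fun w hw => pow_ne_zero _ (div_ne_zero ?_ ?_)
        · exact sub_ne_zero.2 fun h => hρ (h ▸ hw)
        · exact sub_ne_zero.2 fun h => hc (h ▸ hS w (Finset.mem_insert_of_mem hw))
      have : f = (fun z => ∏ w ∈ S, ((z - w) / (c - w)) ^ analyticOrderNatAt f w) * g :=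
        funext hfg
      unfold analyticOrderNatAt
      conv_lhs => rw [this]
      rw [analyticOrderAt_mul hP (hg.analyticAt ρ), (hP.analyticOrderAt_eq_zero).2 hP0, zero_add]
    refine ⟨fun z => (c - ρ) ^ analyticOrderNatAt f ρ * k z, by fun_prop, ?_, fun z => ?_⟩
    · intro w hw
      refine mul_ne_zero (pow_ne_zero _ hcρ) ?_
      rcases Finset.mem_insert.1 hw with rfl | hw
      · exact hkρ
      · intro h
        exact hgS w hw (by rw [hgk w, h, mul_zero])
    · rw [Finset.prod_insert hρ, hfg z, hgk z, ← hord, div_pow]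
      field_simp

/-- The zeros of an entire function in a closed disc are finite in number. -/
lemma finite_zeros_closedBall {f : ℂ → ℂ} (hf : Differentiable ℂ f) {c : ℂ} (hc : f c ≠ 0)
    (R : ℝ) : {z ∈ Metric.closedBall c R | f z = 0}.Finite := by
  by_contra hinf
  obtain ⟨z, -, hz⟩ := Set.Infinite.exists_accPt_of_subset_isCompact
    (K := Metric.closedBall c R) hinf (isCompact_closedBall c R) (fun z hz => hz.1)
  rw [accPt_iff_frequently_nhdsNE] at hz
  have := (AnalyticOnNhd.eqOn_zero_of_preconnected_of_frequently_eq_zero (U := univ)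
    (fun w _ => hf.analyticAt w) isPreconnected_univ (mem_univ z) (hz.mono fun w hw => hw.2))
  exact hc (this (mem_univ c))

/-- A zero-free holomorphic function on a disc with a bound on `|g / g c|` has a small second
logarithmic derivative: Borel-Carathéodory for `log g`, then Cauchy's estimate. -/
lemma norm_deriv_logDeriv_le {g : ℂ → ℂ} (hg : Differentiable ℂ g) {c : ℂ} {R A : ℝ} (hR : 0 < R)
    (hA : 0 < A) (hne : ∀ z ∈ Metric.ball c R, g z ≠ 0)
    (hbd : ∀ z ∈ Metric.ball c R, ‖g z‖ ≤ Real.exp A * ‖g c‖) {z : ℂ}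
    (hz : z ∈ Metric.closedBall c (R / 4)) : ‖deriv (logDeriv g) z‖ ≤ 256 * A / R ^ 2 := by
  have hcR : c ∈ Metric.ball c R := Metric.mem_ball_self hR
  have hld : DifferentiableOn ℂ (logDeriv g) (Metric.ball c R) := fun w hw =>
    (((hg.analyticAt w).deriv.differentiableAt).div (hg w) (hne w hw)).differentiableWithinAt
  obtain ⟨h, hh0, hh⟩ := hld.isExactOn_ball.with_val_at c 0
  -- `h` is the branch of `log (g / g c)` vanishing at `c`
  have hexp : ∀ w ∈ Metric.ball c R, g w = g c * exp (h w) := by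
    have hd : ∀ w ∈ Metric.ball c R, HasDerivAt (fun w => g w * exp (-h w)) 0 w := by
      intro w hw
      have h1 := (hg w).hasDerivAt.mul ((hh w hw).neg.cexp)
      refine h1.congr_deriv ?_
      rw [logDeriv_apply]
      have := hne w hw
      field_simp
      ring
    intro w hw
    have hcst := (convex_ball c R).is_const_of_fderivWithin_eq_zero (𝕜 := ℂ)
      (f := fun w => g w * exp (-h w))
      (fun w hw => (hd w hw).differentiableAt.differentiableWithinAt)
      (fun w hw => by
        rw [fderivWithin_of_isOpen Metric.isOpen_ball hw]
        ext
        simp [(hd w hw).deriv]) hw hcR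
    simp only [hh0, neg_zero, exp_zero, mul_one] at hcst
    rw [← hcst, mul_assoc, ← exp_add]
    simp
  have hre : ∀ w ∈ Metric.ball c R, (h w).re ≤ A := by
    intro w hw
    have h1 := hbd w hw
    rw [hexp w hw, norm_mul, norm_exp, mul_comm] at h1
    have h2 : 0 < ‖g c‖ := norm_pos_iff.2 (hne c hcR)
    exact Real.exp_le_exp.1 (le_of_mul_le_mul_right h1 h2)
  have hhd : DifferentiableOn ℂ h (Metric.ball c R) := fun w hw =>
    (hh w hw).differentiableAt.differentiableWithinAt
  have hbc : ∀ w ∈ Metric.closedBall c (R / 2), ‖h w‖ ≤ 2 * A := by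
    intro w hw
    have hw' : ‖w - c‖ ≤ R / 2 := by simpa [dist_eq_norm] using hw
    have hmaps : ∀ u ∈ Metric.ball (0 : ℂ) R, c + u ∈ Metric.ball c R := by
      intro u hu
      simpa using hu
    have := borelCaratheodory_zero (f := fun u => h (c + u)) hA (R := R) (z := w - c)
      (hhd.comp (by fun_prop) hmaps) (fun u hu => hre _ (hmaps u hu)) hR
      (by simpa using by linarith) (by simpa using hh0)
    rw [add_sub_cancel] at this
    refine this.trans ?_
    rw [div_le_iff₀ (by linarith)]
    nlinarith [norm_nonneg (w - c)]
  have hz' : ‖z - c‖ ≤ R / 4 := by simpa [dist_eq_norm] using hz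
  have hsub : ∀ w ∈ Metric.closedBall z (R / 8), ‖w - c‖ ≤ 3 * R / 8 := by
    intro w hw
    have : ‖w - z‖ ≤ R / 8 := by simpa [dist_eq_norm] using hw
    calc ‖w - c‖ = ‖(w - z) + (z - c)‖ := by ring_nf
      _ ≤ _ := (norm_add_le _ _).trans (by linarith)
  have hdc : DiffContOnCl ℂ h (Metric.ball z (R / 8)) := by
    refine DifferentiableOn.diffContOnCl fun w hw => ?_
    have hw2 := hsub w (Metric.closure_ball_subset_closedBall hw)
    exact (hh w (by simpa [dist_eq_norm] using by linarith)).differentiableAt.differentiableWithinAt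
  have hcau := norm_iteratedDeriv_le_of_forall_mem_sphere_norm_le 2 (by positivity) hdc
    (C := 2 * A) fun w hw => hbc w (by
      have := hsub w (Metric.sphere_subset_closedBall hw)
      simpa [dist_eq_norm] using by linarith)
  have heq : iteratedDeriv 2 h z = deriv (logDeriv g) z := by
    rw [iteratedDeriv_succ, iteratedDeriv_one]
    refine Filter.EventuallyEq.deriv_eq ?_
    filter_upwards [Metric.isOpen_ball.mem_nhds
      (show z ∈ Metric.ball c R by simpa [dist_eq_norm] using by linarith)] with w hw
    exact (hh w hw).deriv
  rw [← heq]
  refine hcau.trans (le_of_eq ?_)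
  simp only [Nat.factorial]
  push_cast
  field_simp
  ring

/-! ### Zero counting and the second logarithmic derivative -/

lemma IsEntireOfOrder.exists_growth {f : ℂ → ℂ} (hf : IsEntireOfOrder f 1) {a : ℝ} (ha : 1 < a)
    (c : ℂ) : ∃ B > 0, ∀ z, ‖f z‖ ≤ Real.exp (B * (1 + ‖z - c‖) ^ a) := by
  obtain ⟨a', ⟨-, hev⟩, haa'⟩ := (isGLB_lt_iff hf.2).1 ha
  rw [← comap_norm_atTop] at hev
  obtain ⟨R, -, hR⟩ := (atTop_basis.comap (norm : ℂ → ℝ)).eventually_iff.1 hev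
  obtain ⟨M, hM⟩ := (isCompact_closedBall (0 : ℂ) (max R 1)).exists_bound_of_continuousOn
    hf.1.continuous.continuousOn
  have hM0 : 0 ≤ M := (norm_nonneg _).trans (hM 0 (by simp))
  refine ⟨(1 + ‖c‖) ^ a + M, by positivity, fun z => ?_⟩
  have h1 : (1 : ℝ) ≤ (1 + ‖z - c‖) ^ a :=
    Real.one_le_rpow (by linarith [norm_nonneg (z - c)]) (by linarith)
  rcases le_total ‖z‖ (max R 1) with hz | hz
  · calc ‖f z‖ ≤ M := hM z (by simpa using hz)
      _ ≤ M * (1 + ‖z - c‖) ^ a := by nlinarith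
      _ ≤ ((1 + ‖c‖) ^ a + M) * (1 + ‖z - c‖) ^ a := by
        gcongr
        have : 0 ≤ (1 + ‖c‖) ^ a := by positivity
        linarith
      _ ≤ _ := by linarith [Real.add_one_le_exp (((1 + ‖c‖) ^ a + M) * (1 + ‖z - c‖) ^ a)]
  · refine (hR (show z ∈ norm ⁻¹' Ici R from (le_max_left _ _).trans hz)).trans
      (Real.exp_le_exp.2 ?_)
    have hzn : ‖z‖ ≤ (1 + ‖c‖) * (1 + ‖z - c‖) := by
      have : ‖z‖ ≤ ‖z - c‖ + ‖c‖ := by simpa using norm_add_le (z - c) c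
      nlinarith [norm_nonneg (z - c), norm_nonneg c]
    calc ‖z‖ ^ a' ≤ ‖z‖ ^ a := Real.rpow_le_rpow_of_exponent_le ((le_max_right _ _).trans hz) haa'.le
      _ ≤ ((1 + ‖c‖) * (1 + ‖z - c‖)) ^ a := by gcongr
      _ = (1 + ‖c‖) ^ a * (1 + ‖z - c‖) ^ a := Real.mul_rpow (by positivity) (by positivity)
      _ ≤ _ := by gcongr; linarith

/-- After division by the zeros in the disc of radius `R`, the maximum principle on the disc of
radius `3 * R`, where every factor has modulus at least `2` on the boundary, gains a factor
`2 ^ n`, with `n` the number of zeros. -/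
lemma two_pow_mul_norm_quotient_le {f g : ℂ → ℂ} (hg : Differentiable ℂ g) {c : ℂ} (hc : f c ≠ 0)
    {R A : ℝ} (hR : 0 < R) {S : Finset ℂ} (hS : ∀ ρ ∈ S, f ρ = 0 ∧ ‖ρ - c‖ ≤ R)
    {m : ℂ → ℕ} (hfg : ∀ z, f z = (∏ ρ ∈ S, ((z - ρ) / (c - ρ)) ^ m ρ) * g z)
    (hA : ∀ z, ‖z - c‖ ≤ 3 * R → ‖f z‖ ≤ A) {z : ℂ} (hz : ‖z - c‖ ≤ 3 * R) :
    2 ^ (∑ ρ ∈ S, m ρ) * ‖g z‖ ≤ A := by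
  rw [← le_div_iff₀' (by positivity)]
  refine norm_le_of_forall_mem_frontier_norm_le (U := Metric.ball c (3 * R)) Metric.isBounded_ball
    hg.diffContOnCl (fun w hw => ?_) ?_
  · rw [frontier_ball _ (by positivity)] at hw
    have hw' : ‖w - c‖ = 3 * R := by simpa [dist_eq_norm] using hw
    rw [le_div_iff₀' (by positivity)]
    refine le_trans ?_ (hA w hw'.le)
    rw [hfg w, norm_mul, norm_prod]
    gcongr
    rw [← Finset.prod_pow_eq_pow_sum]
    refine Finset.prod_le_prod (fun _ _ => by positivity) fun ρ hρ => ?_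
    rw [norm_pow, norm_div]
    refine pow_le_pow_left₀ (by norm_num) ?_ _
    have h0 : 0 < ‖c - ρ‖ := norm_pos_iff.2
      (sub_ne_zero.2 fun h : c = ρ => hc (by rw [h]; exact (hS ρ hρ).1))
    rw [le_div_iff₀ h0]
    have h1 : ‖c - ρ‖ ≤ R := by rw [norm_sub_rev]; exact (hS ρ hρ).2
    have h2 : ‖w - c‖ ≤ ‖w - ρ‖ + ‖c - ρ‖ := by
      simpa using norm_sub_le (w - ρ) (c - ρ)
    linarith
  · rw [closure_ball _ (by positivity)]
    simpa [dist_eq_norm] using hz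

/-- Zero counting: the number of zeros in a disc of radius `R` is `O(R ^ a)`. -/
lemma exists_sum_order_le {f : ℂ → ℂ} (hf : Differentiable ℂ f) {c : ℂ} (hc : f c ≠ 0)
    {a B : ℝ} (ha : 0 < a) (hB : 0 < B) (hfB : ∀ z, ‖f z‖ ≤ Real.exp (B * (1 + ‖z - c‖) ^ a)) :
    ∃ C ≥ 0, ∀ R ≥ 1, ∀ S : Finset ℂ, (∀ ρ ∈ S, f ρ = 0 ∧ ‖ρ - c‖ ≤ R) →
      ∑ ρ ∈ S, (analyticOrderNatAt f ρ : ℝ) ≤ C * R ^ a := by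
  have hl2 : 0 < Real.log 2 := Real.log_pos (by norm_num)
  refine ⟨(B * 4 ^ a + |Real.log ‖f c‖|) / Real.log 2, by positivity, fun R hR S hS => ?_⟩
  obtain ⟨g, hg, -, hfg⟩ := exists_entire_eq_prod_mul hf hc S fun ρ hρ => (hS ρ hρ).1
  have hgc : g c = f c := by
    have h := hfg c
    rw [Finset.prod_eq_one, one_mul] at h
    · exact h.symm
    · intro ρ hρ
      rw [div_self (sub_ne_zero.2 fun h : c = ρ => hc (h ▸ (hS ρ hρ).1)), one_pow]
  have key := two_pow_mul_norm_quotient_le hg hc (R := R) (by linarith) hS hfg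
    (A := Real.exp (B * (1 + 3 * R) ^ a)) (fun z hz => (hfB z).trans (by gcongr))
    (z := c) (by simpa using by linarith)
  rw [hgc] at key
  have h0 : 0 < ‖f c‖ := norm_pos_iff.2 hc
  have h1 := Real.log_le_log (by positivity) key
  rw [Real.log_exp, Real.log_mul (by positivity) h0.ne', Real.log_pow] at h1
  have h2 : (1 + 3 * R) ^ a ≤ 4 ^ a * R ^ a := by
    rw [← Real.mul_rpow (by norm_num) (by linarith)]
    gcongr
    linarith
  have h3 : 1 ≤ R ^ a := Real.one_le_rpow hR ha.le
  rw [div_mul_eq_mul_div, le_div_iff₀ hl2]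
  push_cast at h1
  calc _ ≤ B * (1 + 3 * R) ^ a - Real.log ‖f c‖ := by linarith
    _ ≤ B * (4 ^ a * R ^ a) + |Real.log ‖f c‖| * R ^ a := by
      have := neg_abs_le (Real.log ‖f c‖)
      have := abs_nonneg (Real.log ‖f c‖)
      nlinarith
    _ = _ := by ring

/-- Dyadic decomposition: a family whose counting function is `O(R ^ a)` is summable against
`(1 + r) ^ (-σ)` for every `σ > a`. -/
lemma summable_mul_rpow_of_count_le {ι : Type*} {m r : ι → ℝ} (hm : ∀ i, 0 ≤ m i)
    (hr : ∀ i, 0 ≤ r i) {a σ C : ℝ} (ha : 0 < a) (hσ : a < σ) (hC : 0 ≤ C)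
    (hcount : ∀ R ≥ 1, ∀ T : Finset ι, (∀ i ∈ T, r i ≤ R) → ∑ i ∈ T, m i ≤ C * R ^ a) :
    Summable fun i => m i * (1 + r i) ^ (-σ) := by
  classical
  have hx : (2 : ℝ) ^ (a - σ) < 1 := Real.rpow_lt_one_of_one_lt_of_neg (by norm_num) (by linarith)
  have hx0 : 0 ≤ (2 : ℝ) ^ (a - σ) := by positivity
  refine summable_of_sum_le (c := 2 ^ σ * (C * (1 - 2 ^ (a - σ))⁻¹))
    (fun i => mul_nonneg (hm i) (Real.rpow_nonneg (by linarith [hr i]) _)) fun T => ?_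
  obtain ⟨K, hK⟩ : ∃ K : ℕ, ∀ i ∈ T, r i ≤ 2 ^ K := by
    obtain ⟨K, hK⟩ := pow_unbounded_of_one_lt (∑ i ∈ T, r i) (one_lt_two : (1 : ℝ) < 2)
    exact ⟨K, fun i hi => (Finset.single_le_sum (fun j _ => hr j) hi).trans hK.le⟩
  have hpt : ∀ i ∈ T, (1 + r i) ^ (-σ) ≤
      2 ^ σ * ∑ k ∈ Finset.range (K + 1), if r i ≤ 2 ^ k then ((2 : ℝ) ^ k) ^ (-σ) else 0 := by
    intro i hi
    have hex : ∃ k, r i ≤ (2 : ℝ) ^ k := ⟨K, hK i hi⟩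
    -- the least dyadic scale that contains `r i`; there `1 + r i` is at least `2 ^ k / 2`
    set k := Nat.find hex
    have hkK : k ∈ Finset.range (K + 1) :=
      Finset.mem_range.2 (Nat.lt_succ_of_le (Nat.find_min' hex (hK i hi)))
    have hle : r i ≤ (2 : ℝ) ^ k := Nat.find_spec hex
    have h1 : ((2 : ℝ) ^ k) ^ (-σ) ≤
        ∑ k ∈ Finset.range (K + 1), if r i ≤ 2 ^ k then ((2 : ℝ) ^ k) ^ (-σ) else 0 := by
      refine le_trans ?_ (Finset.single_le_sum (f := fun k : ℕ =>
        if r i ≤ (2 : ℝ) ^ k then ((2 : ℝ) ^ k) ^ (-σ) else 0)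
        (fun j _ => by split_ifs <;> positivity) hkK)
      simp [hle]
    refine le_trans ?_ (mul_le_mul_of_nonneg_left h1 (by positivity))
    have h2 : (2 : ℝ) ^ k / 2 ≤ 1 + r i := by
      rcases Nat.eq_zero_or_pos k with h | h
      · rw [h]
        linarith [hr i]
      · have hlt := Nat.find_min hex (m := k - 1) (by omega)
        rw [not_le] at hlt
        have : (2 : ℝ) ^ k = 2 ^ (k - 1) * 2 := by
          rw [← pow_succ]; congr 1; omega
        rw [this]
        linarith
    calc (1 + r i) ^ (-σ) ≤ ((2 : ℝ) ^ k / 2) ^ (-σ) :=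
          Real.rpow_le_rpow_of_nonpos (by positivity) h2 (by linarith)
      _ = 2 ^ σ * ((2 : ℝ) ^ k) ^ (-σ) := by
          rw [Real.div_rpow (by positivity) (by norm_num), Real.rpow_neg (by norm_num : (0:ℝ) ≤ 2),
            div_inv_eq_mul, mul_comm]
  calc ∑ i ∈ T, m i * (1 + r i) ^ (-σ)
      ≤ ∑ i ∈ T, m i * (2 ^ σ * ∑ k ∈ Finset.range (K + 1),
          if r i ≤ 2 ^ k then ((2 : ℝ) ^ k) ^ (-σ) else 0) :=
        Finset.sum_le_sum fun i hi => mul_le_mul_of_nonneg_left (hpt i hi) (hm i)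
    _ = 2 ^ σ * ∑ k ∈ Finset.range (K + 1),
          ((2 : ℝ) ^ k) ^ (-σ) * ∑ i ∈ T.filter (fun i => r i ≤ 2 ^ k), m i := by
        simp_rw [Finset.mul_sum]
        rw [Finset.sum_comm]
        refine Finset.sum_congr rfl fun k _ => ?_
        rw [Finset.sum_filter]
        refine Finset.sum_congr rfl fun i _ => ?_
        split_ifs <;> ring
    _ ≤ 2 ^ σ * ∑ k ∈ Finset.range (K + 1), C * ((2 : ℝ) ^ (a - σ)) ^ k := by
        refine mul_le_mul_of_nonneg_left (Finset.sum_le_sum fun k _ => ?_) (by positivity)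
        calc ((2 : ℝ) ^ k) ^ (-σ) * ∑ i ∈ T.filter (fun i => r i ≤ 2 ^ k), m i
            ≤ ((2 : ℝ) ^ k) ^ (-σ) * (C * ((2 : ℝ) ^ k) ^ a) := by
              gcongr
              exact hcount _ (one_le_pow₀ (by norm_num)) _ fun i hi => (Finset.mem_filter.1 hi).2
          _ = C * ((2 : ℝ) ^ (a - σ)) ^ k := by
              rw [mul_left_comm, ← Real.rpow_add (by positivity), ← Real.rpow_natCast,
                ← Real.rpow_natCast, ← Real.rpow_mul (by norm_num), ← Real.rpow_mul (by norm_num)]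
              ring_nf
    _ ≤ _ := by
        rw [← Finset.mul_sum]
        gcongr
        rw [← tsum_geometric_of_lt_one hx0 hx]
        exact (summable_geometric_of_lt_one hx0 hx).sum_le_tsum _ (fun _ _ => by positivity)

/-- The exponent of convergence of the zeros is at most one. -/
lemma IsEntireOfOrder.summable_zeros {f : ℂ → ℂ} (hf : IsEntireOfOrder f 1) {c : ℂ} (hc : f c ≠ 0)
    {σ : ℝ} (hσ : 1 < σ) :
    Summable fun ρ : {z : ℂ // f z = 0} =>
      (analyticOrderNatAt f (ρ : ℂ) : ℝ) * (1 + ‖(ρ : ℂ) - c‖) ^ (-σ) := by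
  obtain ⟨a, ha1, haσ⟩ := exists_between hσ
  obtain ⟨B, hB, hfB⟩ := hf.exists_growth ha1 c
  obtain ⟨C, hC, hcount⟩ := exists_sum_order_le hf.1 hc (by linarith) hB hfB
  refine summable_mul_rpow_of_count_le (fun _ => by positivity) (fun _ => norm_nonneg _)
    (by linarith) haσ hC fun R hR T hT => ?_
  have := hcount R hR (T.map (Function.Embedding.subtype _)) (by
    intro ρ hρ
    obtain ⟨w, hw, rfl⟩ := Finset.mem_map.1 hρ
    exact ⟨w.2, hT w hw⟩)
  rwa [Finset.sum_map] at this

/-- Distances to the zeros from two points, one of which is not a zero, are comparable. -/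
lemma exists_one_add_norm_le_mul {f : ℂ → ℂ} (hf : Differentiable ℂ f) (c : ℂ) {z : ℂ}
    (hz : f z ≠ 0) : ∃ K > 0, ∀ ρ, f ρ = 0 → 1 + ‖ρ - c‖ ≤ K * ‖z - ρ‖ := by
  obtain ⟨δ, hδ, hball⟩ := Metric.mem_nhds_iff.1
    (hf.continuous.continuousAt.eventually_ne hz)
  refine ⟨(1 + ‖z - c‖) / δ + 1, by positivity, fun ρ hρ => ?_⟩
  have h1 : δ ≤ ‖z - ρ‖ := by
    by_contra! h
    exact hball (show ρ ∈ Metric.ball z δ by rwa [Metric.mem_ball', dist_eq_norm]) hρ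
  have h2 : ‖ρ - c‖ ≤ ‖z - ρ‖ + ‖z - c‖ := by
    rw [norm_sub_rev z ρ]
    simpa using norm_add_le (ρ - z) (z - c)
  have h3 : 1 + ‖z - c‖ ≤ (1 + ‖z - c‖) / δ * ‖z - ρ‖ := by
    rw [div_mul_eq_mul_div, le_div_iff₀ hδ]
    gcongr
  linarith

/-- Convergence of the zero sum at every point that is not a zero. -/
lemma IsEntireOfOrder.summable_norm_sub {f : ℂ → ℂ} (hf : IsEntireOfOrder f 1) {z : ℂ}
    (hz : f z ≠ 0) {σ : ℝ} (hσ : 1 < σ) :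
    Summable fun ρ : {z : ℂ // f z = 0} =>
      (analyticOrderNatAt f (ρ : ℂ) : ℝ) * ‖z - ρ‖ ^ (-σ) := by
  obtain ⟨K, hK, hle⟩ := exists_one_add_norm_le_mul hf.1 z hz
  refine Summable.of_nonneg_of_le (fun _ => by positivity) (fun ρ => ?_)
    ((hf.summable_zeros hz hσ).mul_left (K ^ σ))
  have h0 : 0 < ‖z - (ρ : ℂ)‖ := norm_pos_iff.2 (sub_ne_zero.2 fun h => hz (h ▸ ρ.2))
  have : ‖z - (ρ : ℂ)‖ ^ (-σ) ≤ K ^ σ * (1 + ‖(ρ : ℂ) - z‖) ^ (-σ) := by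
    calc ‖z - (ρ : ℂ)‖ ^ (-σ) = K ^ σ * (K * ‖z - (ρ : ℂ)‖) ^ (-σ) := by
          rw [Real.mul_rpow hK.le h0.le, ← mul_assoc, ← Real.rpow_add hK]
          simp
      _ ≤ _ := by
          exact mul_le_mul_of_nonneg_left (Real.rpow_le_rpow_of_nonpos (by positivity)
            (hle _ ρ.2) (by linarith)) (by positivity)
  calc _ ≤ (analyticOrderNatAt f (ρ : ℂ) : ℝ) * (K ^ σ * (1 + ‖(ρ : ℂ) - z‖) ^ (-σ)) := by gcongr
    _ = _ := by ring

/-- The second logarithmic derivative after finitely many zeros have been divided out. -/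
lemma deriv_logDeriv_prod_mul {f g : ℂ → ℂ} (hg : Differentiable ℂ g) {c : ℂ} {S : Finset ℂ}
    {m : ℂ → ℕ} (hS : ∀ ρ ∈ S, c ≠ ρ)
    (hfg : ∀ z, f z = (∏ ρ ∈ S, ((z - ρ) / (c - ρ)) ^ m ρ) * g z) {z : ℂ}
    (hz : f z ≠ 0) (hzS : ∀ ρ ∈ S, z ≠ ρ) :
    deriv (logDeriv f) z = -(∑ ρ ∈ S, (m ρ : ℂ) * ((z - ρ) ^ 2)⁻¹) + deriv (logDeriv g) z := by
  have hgz : g z ≠ 0 := fun h => hz (by rw [hfg z, h, mul_zero])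
  have hev : logDeriv f =ᶠ[nhds z]
      fun w => (∑ ρ ∈ S, (m ρ : ℂ) * (w - ρ)⁻¹) + logDeriv g w := by
    have h1 : ∀ᶠ w in nhds z, ∀ ρ ∈ S, w ≠ ρ :=
      (Finset.eventually_all S).2 fun ρ hρ => isOpen_ne.mem_nhds (hzS ρ hρ)
    filter_upwards [h1, hg.continuous.continuousAt.eventually_ne hgz] with w hw hgw
    have hne : ∀ ρ ∈ S, ((w - ρ) / (c - ρ)) ^ m ρ ≠ 0 := fun ρ hρ =>
      pow_ne_zero _ (div_ne_zero (sub_ne_zero.2 (hw ρ hρ)) (sub_ne_zero.2 (hS ρ hρ)))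
    rw [show f = fun z => (∏ ρ ∈ S, ((z - ρ) / (c - ρ)) ^ m ρ) * g z from funext hfg,
      logDeriv_mul w (Finset.prod_ne_zero_iff.2 hne) hgw (by fun_prop) (hg w),
      logDeriv_prod hne (fun ρ _ => by fun_prop)]
    congr 1
    refine Finset.sum_congr rfl fun ρ hρ => ?_
    rw [logDeriv_fun_pow (by fun_prop)]
    have h2 : c - ρ ≠ 0 := sub_ne_zero.2 (hS ρ hρ)
    have h3 : w - ρ ≠ 0 := sub_ne_zero.2 (hw ρ hρ)
    have h4 : HasDerivAt (fun z => (z - ρ) / (c - ρ)) (1 / (c - ρ)) w :=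
      ((hasDerivAt_id w).sub_const ρ).div_const _
    rw [logDeriv_apply, h4.deriv]
    field_simp
  rw [hev.deriv_eq]
  have hgl : DifferentiableAt ℂ (logDeriv g) z :=
    ((hg.analyticAt z).deriv.differentiableAt).div (hg z) hgz
  have hsum : HasDerivAt (fun w => ∑ ρ ∈ S, (m ρ : ℂ) * (w - ρ)⁻¹)
      (∑ ρ ∈ S, (m ρ : ℂ) * (-1 / (z - ρ) ^ 2)) z :=
    HasDerivAt.fun_sum fun ρ hρ => (((hasDerivAt_id z).sub_const ρ).fun_inv
      (sub_ne_zero.2 (hzS ρ hρ))).const_mul _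
  rw [(hsum.fun_add hgl.hasDerivAt).deriv, ← Finset.sum_neg_distrib]
  congr 1
  refine Finset.sum_congr rfl fun ρ _ => ?_
  rw [neg_div, one_div, mul_neg]

/-- The second logarithmic derivative of an entire function of order one is minus the sum of
`(z - ρ)⁻²` over the zeros `ρ`. -/
theorem IsEntireOfOrder.hasSum_deriv_logDeriv {f : ℂ → ℂ} (hf : IsEntireOfOrder f 1) {z : ℂ}
    (hz : f z ≠ 0) :
    HasSum (fun ρ : {z : ℂ // f z = 0} =>
      (analyticOrderNatAt f (ρ : ℂ) : ℂ) * ((z - ρ) ^ 2)⁻¹) (-deriv (logDeriv f) z) := by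
  classical
  have hsum : Summable (fun ρ : {z : ℂ // f z = 0} =>
      (analyticOrderNatAt f (ρ : ℂ) : ℂ) * ((z - ρ) ^ 2)⁻¹) := by
    refine Summable.of_norm ((hf.summable_norm_sub hz (σ := 2) (by norm_num)).congr fun ρ => ?_)
    rw [norm_mul, norm_inv, norm_pow, norm_natCast, Real.rpow_neg (norm_nonneg _),
      Real.rpow_two]
  -- the zeros in the disc of radius `n` about `z`
  set T : ℕ → Finset {w : ℂ // f w = 0} := fun n =>
    (finite_zeros_closedBall hf.1 hz n).toFinset.subtype _ with hT
  have hmem : ∀ n (ρ : {w : ℂ // f w = 0}), ρ ∈ T n ↔ ‖(ρ : ℂ) - z‖ ≤ n := by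
    intro n ρ
    simp [hT, dist_eq_norm, ρ.2]
  have htop : Tendsto T atTop atTop := by
    refine tendsto_atTop_finset_of_monotone (fun n n' h ρ hρ => ?_) fun ρ => ?_
    · rw [hmem] at hρ ⊢
      exact hρ.trans (by exact_mod_cast h)
    · obtain ⟨n, hn⟩ := exists_nat_ge ‖(ρ : ℂ) - z‖
      exact ⟨n, (hmem n ρ).2 hn⟩
  obtain ⟨B, hB, hfB⟩ := hf.exists_growth (a := 3 / 2) (by norm_num) z
  -- a growth exponent `3 / 2 < 2` makes the remainder after the zeros in the disc of radius `n`
  -- tend to zero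
  have hbound : ∀ n : ℕ, 1 ≤ n → ‖(∑ ρ ∈ T n, (analyticOrderNatAt f (ρ : ℂ) : ℂ) *
      ((z - ρ) ^ 2)⁻¹) - -deriv (logDeriv f) z‖ ≤
      256 * (B * 8 + |Real.log ‖f z‖| + 1) * (n : ℝ) ^ (-(1 / 2) : ℝ) := by
    intro n hn
    have hn' : (1 : ℝ) ≤ n := by exact_mod_cast hn
    set S := (T n).map (Function.Embedding.subtype _) with hSdef
    have hS : ∀ ρ ∈ S, f ρ = 0 ∧ ‖ρ - z‖ ≤ n := by
      intro ρ hρ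
      obtain ⟨w, hw, rfl⟩ := Finset.mem_map.1 hρ
      exact ⟨w.2, (hmem n w).1 hw⟩
    have hzS : ∀ ρ ∈ S, z ≠ ρ := fun ρ hρ h => hz (h ▸ (hS ρ hρ).1)
    obtain ⟨g, hg, hgS, hfg⟩ := exists_entire_eq_prod_mul hf.1 hz S fun ρ hρ => (hS ρ hρ).1
    have hgz : g z = f z := by
      have h := hfg z
      rw [Finset.prod_eq_one, one_mul] at h
      · exact h.symm
      · intro ρ hρ
        rw [div_self (sub_ne_zero.2 (hzS ρ hρ)), one_pow]
    have hgne : ∀ w ∈ Metric.ball z n, g w ≠ 0 := by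
      intro w hw h
      have hfw : f w = 0 := by rw [hfg w, h, mul_zero]
      refine hgS w (Finset.mem_map.2 ⟨⟨w, hfw⟩, (hmem n _).2 ?_, rfl⟩) h
      simpa [dist_eq_norm] using (Metric.mem_ball.1 hw).le
    have hgle : ∀ w, ‖w - z‖ ≤ 3 * n →
        ‖g w‖ ≤ Real.exp (B * (1 + 3 * n) ^ (3 / 2 : ℝ)) := by
      intro w hw
      have := two_pow_mul_norm_quotient_le hg hz (R := n) (by linarith) hS hfg
        (A := Real.exp (B * (1 + 3 * n) ^ (3 / 2 : ℝ))) (fun u hu => (hfB u).trans (by gcongr)) hw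
      refine le_trans ?_ this
      exact le_mul_of_one_le_left (norm_nonneg _) (one_le_pow₀ (by norm_num))
    have hn32 : 1 ≤ (n : ℝ) ^ (3 / 2 : ℝ) := Real.one_le_rpow hn' (by norm_num)
    have h8 : (1 + 3 * n : ℝ) ^ (3 / 2 : ℝ) ≤ 8 * (n : ℝ) ^ (3 / 2 : ℝ) := by
      calc (1 + 3 * n : ℝ) ^ (3 / 2 : ℝ) ≤ (4 * n) ^ (3 / 2 : ℝ) := by gcongr; linarith
        _ = _ := by
          rw [Real.mul_rpow (by norm_num) (by positivity)]
          congr 1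
          rw [show (4 : ℝ) = 2 ^ (2 : ℝ) by norm_num, ← Real.rpow_mul (by norm_num)]
          norm_num
    have h0 : 0 < ‖f z‖ := norm_pos_iff.2 hz
    have hder := norm_deriv_logDeriv_le hg (c := z) (R := n)
      (A := (B * 8 + |Real.log ‖f z‖| + 1) * (n : ℝ) ^ (3 / 2 : ℝ)) (by linarith) (by positivity)
      hgne (fun w hw => by
        have hw' : ‖w - z‖ ≤ 3 * n := by
          have := Metric.mem_ball.1 hw
          rw [dist_eq_norm] at this
          linarith
        refine (hgle w hw').trans ?_
        have e : ∀ A : ℝ, Real.exp A * ‖f z‖ = Real.exp (A + Real.log ‖f z‖) := fun A => by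
          rw [Real.exp_add, Real.exp_log h0]
        rw [hgz, e]
        refine Real.exp_le_exp.2 ?_
        have := neg_abs_le (Real.log ‖f z‖)
        have := abs_nonneg (Real.log ‖f z‖)
        nlinarith) (z := z) (Metric.mem_closedBall_self (by positivity))
    have hform := deriv_logDeriv_prod_mul hg hzS hfg hz hzS
    rw [hSdef, Finset.sum_map] at hform
    simp only [Function.Embedding.subtype_apply] at hform
    rw [hform]
    have : ∀ A D : ℂ, A - -(-A + D) = D := fun A D => by ring
    rw [this]
    refine hder.trans (le_of_eq ?_)
    rw [show (-(1 / 2) : ℝ) = 3 / 2 - 2 by norm_num, Real.rpow_sub (by linarith), Real.rpow_two]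
    ring
  have hlim : Tendsto (fun n : ℕ => ∑ ρ ∈ T n, (analyticOrderNatAt f (ρ : ℂ) : ℂ) *
      ((z - ρ) ^ 2)⁻¹) atTop (nhds (-deriv (logDeriv f) z)) := by
    rw [tendsto_iff_norm_sub_tendsto_zero]
    refine squeeze_zero' (Eventually.of_forall fun _ => norm_nonneg _)
      ((eventually_ge_atTop 1).mono hbound) ?_
    have := (tendsto_rpow_neg_atTop (y := 1 / 2) (by norm_num)).comp tendsto_natCast_atTop_atTop
    simpa using this.const_mul (256 * (B * 8 + |Real.log ‖f z‖| + 1))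
  rw [tendsto_nhds_unique hlim (hsum.hasSum.comp htop)]
  exact hsum.hasSum

/-! ### The beta integral on the slit plane -/

lemma integrableOn_rpow_mul_inv_one_add_sq {p : ℝ} (h0 : -1 < p) (h1 : p < 1) :
    IntegrableOn (fun y : ℝ => y ^ p * ((1 + y) ^ 2)⁻¹) (Ioi 0) := by
  have hc : ContinuousOn (fun y : ℝ => ((1 + y) ^ 2)⁻¹) (Ioi 0) := by
    refine ContinuousOn.inv₀ (by fun_prop) fun y hy => ?_
    have : (0 : ℝ) < y := hy
    positivity
  have := mellin_convergent_of_isBigO_scalar (a := 2) (b := 0) (s := p + 1)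
    (hc.locallyIntegrableOn measurableSet_Ioi) ?_ (by linarith) ?_ (by linarith)
  · simpa using this
  · refine IsBigO.of_bound 1 ?_
    filter_upwards [eventually_gt_atTop 0] with y hy
    rw [Real.rpow_neg hy.le, Real.rpow_two, one_mul, Real.norm_of_nonneg (by positivity),
      Real.norm_of_nonneg (by positivity)]
    gcongr
    linarith
  · refine IsBigO.of_bound 1 ?_
    filter_upwards [self_mem_nhdsWithin] with y (hy : 0 < y)
    rw [neg_zero, Real.rpow_zero, Real.norm_of_nonneg (by positivity), norm_one, mul_one]
    exact inv_le_one_of_one_le₀ (one_le_pow₀ (by linarith))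

/-- Euler's beta integral in the form `∫₀^∞ y ^ (u - 1) (1 + y)⁻² dy = Γ(u) Γ(2 - u)`. -/
lemma mellin_inv_one_add_sq {u : ℂ} (h0 : 0 < u.re) (h2 : u.re < 2) :
    mellin (fun y : ℝ => ((1 + (y : ℂ)) ^ 2)⁻¹) u = Gamma u * Gamma (2 - u) := by
  have hB := Gamma_mul_Gamma_eq_betaIntegral (s := u) (t := 2 - u) h0 (by simpa using h2)
  rw [add_sub_cancel, show (2 : ℂ) = 1 + 1 by norm_num, Complex.Gamma_add_one 1 one_ne_zero,
    Complex.Gamma_one, one_mul, one_mul, show (1 + 1 : ℂ) = 2 by norm_num] at hB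
  rw [hB, betaIntegral, intervalIntegral.integral_of_le zero_le_one]
  -- the substitution `y = v / (1 - v)`
  have himg : (fun v : ℝ => v / (1 - v)) '' Ioo 0 1 = Ioi 0 := by
    ext y
    constructor
    · rintro ⟨v, ⟨hv0, hv1⟩, rfl⟩
      exact div_pos hv0 (by linarith)
    · intro (hy : 0 < y)
      refine ⟨y / (1 + y), ⟨by positivity, ?_⟩, ?_⟩
      · rw [div_lt_one (by linarith)]; linarith
      · have : 1 + y ≠ 0 := by positivity
        field_simp
        ring
  have hder : ∀ v ∈ Ioo (0 : ℝ) 1,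
      HasDerivWithinAt (fun v : ℝ => v / (1 - v)) (((1 - v) ^ 2)⁻¹) (Ioo 0 1) v := by
    intro v hv
    have hne : 1 - v ≠ 0 := by linarith [hv.2]
    have := ((hasDerivAt_id v).div ((hasDerivAt_id v).const_sub 1) hne).hasDerivWithinAt
      (s := Ioo 0 1)
    refine this.congr_deriv ?_
    simp
  have hinj : InjOn (fun v : ℝ => v / (1 - v)) (Ioo 0 1) := by
    intro v hv w hw h
    have h1 : 1 - v ≠ 0 := by linarith [hv.2]
    have h2 : 1 - w ≠ 0 := by linarith [hw.2]
    simp only at h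
    rw [div_eq_div_iff h1 h2] at h
    linarith
  rw [mellin, ← himg, integral_image_eq_integral_abs_deriv_smul measurableSet_Ioo hder hinj,
    integral_Ioc_eq_integral_Ioo]
  refine setIntegral_congr_fun measurableSet_Ioo fun v hv => ?_
  have hv0 : 0 < v := hv.1
  have hv1 : 0 < 1 - v := by linarith [hv.2]
  have hvc : (1 - (v : ℂ)) ≠ 0 := by exact_mod_cast hv1.ne'
  have e1 : ((v / (1 - v) : ℝ) : ℂ) ^ (u - 1) = (v : ℂ) ^ (u - 1) * (1 - (v : ℂ)) ^ (1 - u) := by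
    rw [div_eq_mul_inv, ofReal_mul, mul_cpow_ofReal_nonneg hv0.le (by positivity), ofReal_inv,
      inv_cpow _ _ (by rw [arg_ofReal_of_nonneg hv1.le]; exact Real.pi_pos.ne), ← cpow_neg]
    push_cast
    ring_nf
  have e2 : (1 + ((v / (1 - v) : ℝ) : ℂ)) = (1 - (v : ℂ))⁻¹ := by
    push_cast
    field_simp
    ring
  simp only [smul_eq_mul, real_smul]
  rw [e1, e2, abs_of_nonneg (by positivity)]
  push_cast
  rw [show 2 - u - 1 = 1 - u by ring]
  field_simp

/-- A point of the slit plane stays away from `(-∞, 0]`, in a scale-invariant sense. -/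
lemma exists_mul_one_add_le_norm_add {a : ℂ} (ha : a ∈ slitPlane) :
    ∃ δ > 0, ∀ y : ℝ, 0 ≤ y → δ * (1 + y) ≤ ‖a + y‖ := by
  have hne : ∀ y : ℝ, 0 ≤ y → a + y ≠ 0 := by
    intro y hy h
    rw [eq_neg_of_add_eq_zero_left h, mem_slitPlane_iff] at ha
    rcases ha with h | h
    · simp at h; linarith
    · simp at h
  obtain ⟨y₀, hy₀, hmin⟩ := (isCompact_Icc (a := (0 : ℝ)) (b := 1 + 2 * ‖a‖)).exists_isMinOn
    ⟨0, by simp; positivity⟩ (f := fun y : ℝ => ‖a + y‖) (by fun_prop)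
  have hpos : 0 < ‖a + y₀‖ := norm_pos_iff.2 (hne y₀ hy₀.1)
  refine ⟨min (1 / 2) (‖a + y₀‖ / (2 + 2 * ‖a‖)), by positivity, fun y hy => ?_⟩
  rcases le_total y (1 + 2 * ‖a‖) with h | h
  · calc min (1 / 2) (‖a + y₀‖ / (2 + 2 * ‖a‖)) * (1 + y)
        ≤ ‖a + y₀‖ / (2 + 2 * ‖a‖) * (2 + 2 * ‖a‖) := by
          exact mul_le_mul (min_le_right _ _) (by linarith) (by linarith) (by positivity)
      _ = ‖a + y₀‖ := by field_simp
      _ ≤ _ := hmin ⟨hy, h⟩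
  · have h1 : y ≤ ‖a + y‖ + ‖a‖ := by
      have := norm_sub_le (a + y) a
      rwa [add_sub_cancel_left, norm_real, Real.norm_of_nonneg hy] at this
    calc _ ≤ 1 / 2 * (1 + y) := by gcongr; exact min_le_left _ _
      _ ≤ _ := by linarith

lemma norm_cpow_smul_inv_sq_le {a u : ℂ} {δ r y : ℝ} (hδ : 0 < δ) (hr : 0 < r) (hy : 0 < y)
    (h : δ * (r + y) ≤ ‖a + y‖) :
    ‖(y : ℂ) ^ (u - 1) • ((a + y) ^ 2)⁻¹‖ ≤
      (δ ^ 2)⁻¹ * (y ^ (u.re - 1) * ((r + y) ^ 2)⁻¹) := by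
  rw [norm_smul, norm_cpow_eq_rpow_re_of_pos hy, norm_inv, norm_pow]
  have : (‖a + y‖ ^ 2)⁻¹ ≤ ((δ * (r + y)) ^ 2)⁻¹ := by gcongr
  calc _ ≤ y ^ (u.re - 1) * ((δ * (r + y)) ^ 2)⁻¹ := by
        simp only [sub_re, one_re]
        gcongr
    _ = _ := by rw [mul_pow, mul_inv]; ring

lemma aestronglyMeasurable_cpow_smul {g : ℝ → ℂ} (hg : ContinuousOn g (Ioi 0)) (u : ℂ) :
    AEStronglyMeasurable (fun y : ℝ => (y : ℂ) ^ (u - 1) • g y) (volume.restrict (Ioi 0)) := by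
  refine ContinuousOn.aestronglyMeasurable (ContinuousOn.fun_smul ?_ hg) measurableSet_Ioi
  intro y hy
  exact ((continuousAt_ofReal_cpow_const y (u - 1) (Or.inr (ne_of_gt hy)))).continuousWithinAt

lemma add_ofReal_ne_zero_of_slitPlane {a : ℂ} (ha : a ∈ slitPlane) {y : ℝ} (hy : 0 ≤ y) :
    a + y ≠ 0 := by
  obtain ⟨δ, hδ, h⟩ := exists_mul_one_add_le_norm_add ha
  exact norm_pos_iff.1 (lt_of_lt_of_le (by positivity) (h y hy))

lemma mellinConvergent_inv_add_sq {a : ℂ} (ha : a ∈ slitPlane) {u : ℂ} (h0 : 0 < u.re)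
    (h2 : u.re < 2) : MellinConvergent (fun y : ℝ => ((a + (y : ℂ)) ^ 2)⁻¹) u := by
  obtain ⟨δ, hδ, h⟩ := exists_mul_one_add_le_norm_add ha
  have hi := (integrableOn_rpow_mul_inv_one_add_sq (p := u.re - 1) (by linarith)
    (by linarith)).const_mul (δ ^ 2)⁻¹
  refine Integrable.mono' hi (aestronglyMeasurable_cpow_smul ?_ u) ?_
  · refine ContinuousOn.inv₀ (by fun_prop) fun y hy => ?_
    exact pow_ne_zero _ (add_ofReal_ne_zero_of_slitPlane ha (le_of_lt hy))
  · filter_upwards [ae_restrict_mem measurableSet_Ioi] with y (hy : 0 < y)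
    exact norm_cpow_smul_inv_sq_le hδ one_pos hy (h y hy.le)

lemma differentiableOn_mellin_inv_add_sq {u : ℂ} (h0 : 0 < u.re) (h2 : u.re < 2) :
    DifferentiableOn ℂ (fun a : ℂ => mellin (fun y : ℝ => ((a + (y : ℂ)) ^ 2)⁻¹) u)
      slitPlane := by
  intro a ha
  obtain ⟨δ, hδ, h⟩ := exists_mul_one_add_le_norm_add ha
  have hnear : ∀ b ∈ Metric.ball a (δ / 2), ∀ y : ℝ, 0 ≤ y → δ / 2 * (1 + y) ≤ ‖b + y‖ := by
    intro b hb y hy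
    have hb' : ‖b - a‖ < δ / 2 := by simpa [dist_eq_norm] using hb
    have h1 : ‖a + y‖ ≤ ‖b + y‖ + ‖b - a‖ := by
      have := norm_sub_le (b + y) (b - a)
      rwa [show b + y - (b - a) = a + y by ring] at this
    nlinarith [h y hy]
  have hne : ∀ b ∈ Metric.ball a (δ / 2), ∀ y : ℝ, 0 ≤ y → b + y ≠ 0 := fun b hb y hy =>
    norm_pos_iff.1 (lt_of_lt_of_le (by positivity) (hnear b hb y hy))
  have hi := (integrableOn_rpow_mul_inv_one_add_sq (p := u.re - 1) (by linarith)
    (by linarith)).const_mul (2 * ((δ / 2) ^ 3)⁻¹)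
  have hcont : ∀ b ∈ Metric.ball a (δ / 2), ∀ n : ℕ,
      ContinuousOn (fun y : ℝ => ((b + (y : ℂ)) ^ n)⁻¹) (Ioi 0) := fun b hb n =>
    ContinuousOn.inv₀ (by fun_prop) fun y hy => pow_ne_zero _ (hne b hb y (le_of_lt hy))
  have hball : Metric.ball a (δ / 2) ∈ nhds a := Metric.ball_mem_nhds _ (by positivity)
  have ha' : a ∈ Metric.ball a (δ / 2) := Metric.mem_ball_self (by positivity)
  have := (hasDerivAt_integral_of_dominated_loc_of_deriv_le (μ := volume.restrict (Ioi 0))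
    (F := fun b (y : ℝ) => (y : ℂ) ^ (u - 1) • ((b + (y : ℂ)) ^ 2)⁻¹)
    (F' := fun b (y : ℝ) => (y : ℂ) ^ (u - 1) • (-2 * ((b + (y : ℂ)) ^ 3)⁻¹))
    (bound := fun y => 2 * ((δ / 2) ^ 3)⁻¹ * (y ^ (u.re - 1) * ((1 + y) ^ 2)⁻¹))
    hball ?_ ?_ ?_ ?_ hi ?_).2
  · exact this.differentiableAt.differentiableWithinAt
  · filter_upwards [hball] with b hb
    exact aestronglyMeasurable_cpow_smul (hcont b hb 2) u
  · exact mellinConvergent_inv_add_sq ha h0 h2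
  · exact aestronglyMeasurable_cpow_smul (continuousOn_const.mul (hcont a ha' 3)) u
  · filter_upwards [ae_restrict_mem measurableSet_Ioi] with y (hy : 0 < y) b hb
    rw [norm_smul, norm_cpow_eq_rpow_re_of_pos hy, norm_mul, norm_inv, norm_pow]
    have h1 : (‖b + y‖ ^ 3)⁻¹ ≤ ((δ / 2 * (1 + y)) ^ 3)⁻¹ := by
      have := hnear b hb y hy.le
      gcongr
    have h3 : ((1 + y) ^ 3)⁻¹ ≤ ((1 + y) ^ 2)⁻¹ := by
      gcongr
      · linarith
      · norm_num
    calc _ ≤ y ^ (u.re - 1) * (2 * ((δ / 2 * (1 + y)) ^ 3)⁻¹) := by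
          simp only [sub_re, one_re, norm_neg, norm_ofNat]
          gcongr
      _ = 2 * ((δ / 2) ^ 3)⁻¹ * (y ^ (u.re - 1) * ((1 + y) ^ 3)⁻¹) := by
          rw [mul_pow, mul_inv]; ring
      _ ≤ _ := by gcongr
  · filter_upwards [ae_restrict_mem measurableSet_Ioi] with y (hy : 0 < y) b hb
    have hb0 := hne b hb y hy.le
    have h1 : HasDerivAt (fun b : ℂ => ((b + (y : ℂ)) ^ 2)⁻¹) (-2 * ((b + (y : ℂ)) ^ 3)⁻¹) b := by
      refine ((((hasDerivAt_id b).add_const (y : ℂ)).fun_pow 2).fun_inv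
        (pow_ne_zero _ hb0)).congr_deriv ?_
      simp only [id]
      field_simp
      push_cast
      ring
    exact h1.fun_const_smul _

/-- The Mellin transform of `(a + y)⁻²`, by analytic continuation in `a` from `a > 0`. -/
lemma mellin_inv_add_sq {a : ℂ} (ha : a ∈ slitPlane) {u : ℂ} (h0 : 0 < u.re) (h2 : u.re < 2) :
    mellin (fun y : ℝ => ((a + (y : ℂ)) ^ 2)⁻¹) u = a ^ (u - 2) * (Gamma u * Gamma (2 - u)) := by
  have hreal : ∀ r : ℝ, 0 < r → mellin (fun y : ℝ => (((r : ℂ) + (y : ℂ)) ^ 2)⁻¹) u =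
      (r : ℂ) ^ (u - 2) * (Gamma u * Gamma (2 - u)) := by
    intro r hr
    have hrc : (r : ℂ) ≠ 0 := by exact_mod_cast hr.ne'
    have h := mellin_comp_mul_left (fun y : ℝ => ((1 + (y : ℂ)) ^ 2)⁻¹) u (inv_pos.2 hr)
    rw [mellin_inv_one_add_sq h0 h2] at h
    have h' := mellin_const_smul (fun y : ℝ => ((1 + ((r⁻¹ * y : ℝ) : ℂ)) ^ 2)⁻¹) u
      (((r : ℂ) ^ 2)⁻¹)
    rw [h] at h'
    have hfun : (fun y : ℝ => (((r : ℂ) + (y : ℂ)) ^ 2)⁻¹) =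
        fun y : ℝ => ((r : ℂ) ^ 2)⁻¹ • ((1 + ((r⁻¹ * y : ℝ) : ℂ)) ^ 2)⁻¹ := by
      funext y
      rw [smul_eq_mul, ← mul_inv, ← mul_pow]
      push_cast
      congr 2
      field_simp
    rw [hfun, h', cpow_sub _ _ hrc, ofReal_inv,
      inv_cpow _ _ (by rw [arg_ofReal_of_nonneg hr.le]; exact Real.pi_pos.ne), cpow_neg, inv_inv,
      smul_eq_mul, smul_eq_mul, cpow_ofNat]
    field_simp
  have hopen : IsOpen slitPlane := isOpen_slitPlane
  have hL := (differentiableOn_mellin_inv_add_sq h0 h2).analyticOnNhd hopen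
  have hRd : DifferentiableOn ℂ (fun a : ℂ => a ^ (u - 2) * (Gamma u * Gamma (2 - u)))
      slitPlane := fun a ha =>
    ((differentiableAt_id.cpow_const ha).mul_const _).differentiableWithinAt
  have hR := hRd.analyticOnNhd hopen
  refine hL.eqOn_of_preconnected_of_frequently_eq hR
    (starConvex_one_slitPlane.isPathConnected
      one_mem_slitPlane).isConnected.isPreconnected (z₀ := 1) one_mem_slitPlane ?_ ha
  -- the points `1 + 1 / (n + 1)` accumulate at `1`
  have ht : Tendsto (fun n : ℕ => ((1 + 1 / ((n : ℝ) + 1) : ℝ) : ℂ)) atTop (nhdsWithin 1 {1}ᶜ) := by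
    refine tendsto_nhdsWithin_iff.2 ⟨?_, Eventually.of_forall fun n => ?_⟩
    · have := tendsto_one_div_add_atTop_nhds_zero_nat (𝕜 := ℝ)
      have h1 := (this.const_add 1)
      rw [add_zero] at h1
      exact (continuous_ofReal.tendsto 1).comp h1
    · have : (0 : ℝ) < 1 / ((n : ℝ) + 1) := by positivity
      intro h
      have h' : (1 + 1 / ((n : ℝ) + 1) : ℝ) = 1 := ofReal_injective h
      linarith
  refine ht.frequently (Frequently.of_forall fun n => ?_)
  exact hreal _ (by positivity)

/-- The reflection formula in the form needed to remove the gamma factors. -/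
lemma sin_div_pi_mul_Gamma_mul_Gamma {s : ℂ} (h1 : 0 < s.re) (h2 : s.re < 2) (hs : s ≠ 1) :
    sin ((Real.pi : ℂ) * s) / (Real.pi : ℂ) * (Gamma (2 - s) * Gamma s) = 1 - s := by
  have hpi : (Real.pi : ℂ) ≠ 0 := by exact_mod_cast Real.pi_ne_zero
  have h := Gamma_mul_Gamma_one_sub s
  have hG : Gamma (2 - s) = (1 - s) * Gamma (1 - s) := by
    rw [show 2 - s = (1 - s) + 1 by ring, Complex.Gamma_add_one _ (sub_ne_zero.2 hs.symm)]
  have hsin : sin ((Real.pi : ℂ) * s) ≠ 0 := by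
    intro h0
    rw [h0, div_zero] at h
    rcases mul_eq_zero.1 h with h | h
    · exact Gamma_ne_zero_of_re_pos h1 h
    · rw [h, mul_zero] at hG
      exact Gamma_ne_zero_of_re_pos (s := 2 - s) (by simpa using h2) hG
  rw [hG, show (1 - s) * Gamma (1 - s) * Gamma s = (1 - s) * (Gamma s * Gamma (1 - s)) by ring, h]
  field_simp

/-! ### Zeta functions over zeros as Mellin transforms -/

lemma IsEligible.apply_add_ne_zero {f : ℂ → ℂ} {x : ℂ} (hx : IsEligible f x) {y : ℝ}
    (hy : 0 ≤ y) : f (x + y) ≠ 0 := by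
  intro h
  refine add_ofReal_ne_zero_of_slitPlane (hx _ h) hy ?_
  ring

lemma IsEligible.apply_ne_zero {f : ℂ → ℂ} {x : ℂ} (hx : IsEligible f x) : f x ≠ 0 := by
  simpa using hx.apply_add_ne_zero le_rfl

/-- If the real parts of the zeros are bounded above, then the sectors avoided by the points
`x - ρ` can be chosen uniformly: far zeros have `x - ρ` close to a half-plane, and only finitely
many zeros remain. -/
lemma exists_mul_norm_add_le {f : ℂ → ℂ} (hf : Differentiable ℂ f)
    (hre : ∀ ρ, f ρ = 0 → ρ.re ≤ 1) {x : ℂ} (hx : IsEligible f x) :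
    ∃ δ > 0, ∀ ρ, f ρ = 0 → ∀ y : ℝ, 0 ≤ y → δ * (‖x - ρ‖ + y) ≤ ‖x - ρ + y‖ := by
  -- beyond this distance `Re (x - ρ) ≥ -‖x - ρ‖ / 4`, which allows `δ = 1 / 2`
  set R : ℝ := 4 * (|x.re| + 1)
  have hfin := finite_zeros_closedBall hf hx.apply_ne_zero R
  have hnear : ∀ᶠ δ in nhdsWithin (0 : ℝ) (Ioi 0), ∀ ρ ∈ {z ∈ Metric.closedBall x R | f z = 0},
      ∀ y : ℝ, 0 ≤ y → δ * (‖x - ρ‖ + y) ≤ ‖x - ρ + y‖ := by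
    rw [eventually_all_finite hfin]
    rintro ρ ⟨-, hρ⟩
    obtain ⟨δ₀, hδ₀, h⟩ := exists_mul_one_add_le_norm_add (hx ρ hρ)
    have hpos : 0 < δ₀ / (1 + ‖x - ρ‖) := by positivity
    filter_upwards [Ioo_mem_nhdsGT hpos] with δ hδ y hy
    refine le_trans ?_ (h y hy)
    have h1 : δ * (1 + ‖x - ρ‖) ≤ δ₀ := by
      rw [← le_div_iff₀ (by positivity)]
      exact hδ.2.le
    have h2 := hδ.1
    have h3 : 0 ≤ ‖x - ρ‖ := norm_nonneg _
    calc δ * (‖x - ρ‖ + y) ≤ δ * ((1 + ‖x - ρ‖) * (1 + y)) := by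
          gcongr
          nlinarith
      _ = δ * (1 + ‖x - ρ‖) * (1 + y) := by ring
      _ ≤ _ := by gcongr
  obtain ⟨δ, hδnear, hδ⟩ := (hnear.and (Ioo_mem_nhdsGT (show (0 : ℝ) < 1 / 2 by norm_num))).exists
  refine ⟨δ, hδ.1, fun ρ hρ y hy => ?_⟩
  by_cases hR : ρ ∈ Metric.closedBall x R
  · exact hδnear ρ ⟨hR, hρ⟩ y hy
  · have hR' : R < ‖x - ρ‖ := by
      rw [norm_sub_rev]
      simpa [dist_eq_norm] using hR
    set a := x - ρ with ha
    have hare : -(‖a‖ / 4) ≤ a.re := by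
      have h1 : a.re = x.re - ρ.re := by simp [ha]
      have := neg_abs_le x.re
      have := hre ρ hρ
      rw [h1]
      linarith
    have hsq : ‖a + y‖ ^ 2 = ‖a‖ ^ 2 + 2 * y * a.re + y ^ 2 := by
      simp only [Complex.sq_norm, normSq_apply, add_re, ofReal_re, add_im, ofReal_im]
      ring
    have h0 : 0 ≤ ‖a‖ := norm_nonneg _
    have hhalf : 1 / 2 * (‖a‖ + y) ≤ ‖a + y‖ := by
      refine le_of_abs_le (abs_le_of_sq_le_sq ?_ (norm_nonneg _))
      rw [hsq]
      nlinarith [sq_nonneg (‖a‖ - y), mul_nonneg h0 hy, mul_le_mul_of_nonneg_left hare hy]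
    exact le_trans (by have := hδ.2.le; gcongr) hhalf

lemma countable_zeros {f : ℂ → ℂ} (hf : Differentiable ℂ f) {c : ℂ} (hc : f c ≠ 0) :
    Countable {z : ℂ // f z = 0} := by
  have : {z : ℂ | f z = 0} = ⋃ n : ℕ, {z ∈ Metric.closedBall c n | f z = 0} := by
    ext z
    simp only [mem_ofPred_eq, mem_iUnion, Metric.mem_closedBall]
    refine ⟨fun h => ?_, fun ⟨_, _, h⟩ => h⟩
    obtain ⟨n, hn⟩ := exists_nat_ge (dist z c)
    exact ⟨n, hn, h⟩
  refine Set.Countable.to_subtype (s := {z : ℂ | f z = 0}) ?_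
  rw [this]
  exact countable_iUnion fun n => (finite_zeros_closedBall hf hc n).countable

lemma integral_rpow_mul_inv_add_sq (σ : ℝ) {r : ℝ} (hr : 0 < r) :
    ∫ y in Ioi (0 : ℝ), y ^ (1 - σ) * ((r + y) ^ 2)⁻¹ =
      r ^ (-σ) * ∫ y in Ioi (0 : ℝ), y ^ (1 - σ) * ((1 + y) ^ 2)⁻¹ := by
  have h := integral_comp_mul_left_Ioi (fun y : ℝ => y ^ (1 - σ) * ((r + y) ^ 2)⁻¹) 0 hr
  rw [mul_zero, eq_inv_smul_iff₀ hr.ne', smul_eq_mul] at h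
  rw [← h, ← integral_const_mul, ← integral_const_mul]
  refine setIntegral_congr_fun measurableSet_Ioi fun y (hy : 0 < y) => ?_
  have : r + r * y = r * (1 + y) := by ring
  rw [this, mul_pow, mul_inv, Real.mul_rpow hr.le hy.le, Real.rpow_sub hr, Real.rpow_one,
    Real.rpow_neg hr.le]
  field_simp

/-- Termwise Mellin transform of the second logarithmic derivative along a horizontal ray. -/
theorem IsEntireOfOrder.hasSum_mellin {f : ℂ → ℂ} (hf : IsEntireOfOrder f 1)
    (hre : ∀ ρ, f ρ = 0 → ρ.re ≤ 1) {x : ℂ} (hx : IsEligible f x) {s : ℂ} (h1 : 1 < s.re)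
    (h2 : s.re < 2) :
    HasSum (fun ρ : {z : ℂ // f z = 0} =>
      (analyticOrderNatAt f (ρ : ℂ) : ℂ) * (x - ρ) ^ (-s) * (Gamma (2 - s) * Gamma s))
      (mellin (fun y : ℝ => -deriv (logDeriv f) (x + y)) (2 - s)) := by
  have hcount := countable_zeros hf.1 hx.apply_ne_zero
  obtain ⟨δ, hδ, hsec⟩ := exists_mul_norm_add_le hf.1 hre hx
  have hu0 : 0 < (2 - s).re := by simpa using h2
  have hu2 : (2 - s).re < 2 := by simp; linarith
  set F : {z : ℂ // f z = 0} → ℝ → ℂ := fun ρ y =>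
    (analyticOrderNatAt f (ρ : ℂ) : ℂ) * ((y : ℂ) ^ (2 - s - 1) • ((x - ρ + y) ^ 2)⁻¹) with hF
  have hFint : ∀ ρ, Integrable (F ρ) (volume.restrict (Ioi 0)) := fun ρ =>
    (mellinConvergent_inv_add_sq (hx ρ ρ.2) hu0 hu2).const_mul _
  have hpos : ∀ ρ : {z : ℂ // f z = 0}, 0 < ‖x - ρ‖ := fun ρ =>
    norm_pos_iff.2 (slitPlane_ne_zero (hx ρ ρ.2))
  have hbase := integrableOn_rpow_mul_inv_one_add_sq (p := 1 - s.re) (by linarith) (by linarith)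
  have hre1 : (2 - s).re - 1 = 1 - s.re := by simp; ring
  have hFsum : Summable fun ρ => ∫ y in Ioi (0 : ℝ), ‖F ρ y‖ := by
    refine Summable.of_nonneg_of_le (fun ρ => integral_nonneg fun _ => norm_nonneg _)
      (fun ρ => ?_) ((hf.summable_norm_sub hx.apply_ne_zero h1).mul_right
        ((δ ^ 2)⁻¹ * ∫ y in Ioi (0 : ℝ), y ^ (1 - s.re) * ((1 + y) ^ 2)⁻¹))
    have hint : IntegrableOn (fun y : ℝ => y ^ (1 - s.re) * ((‖x - ρ‖ + y) ^ 2)⁻¹) (Ioi 0) := by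
      refine Integrable.mono' (hbase.const_mul ((min 1 ‖x - ρ‖ ^ 2)⁻¹)) ?_ ?_
      · refine ContinuousOn.aestronglyMeasurable (ContinuousOn.mul ?_ ?_) measurableSet_Ioi
        · exact continuousOn_id.rpow_const fun y hy => Or.inl (ne_of_gt hy)
        · refine ContinuousOn.inv₀ (by fun_prop) fun y (hy : 0 < y) => ?_
          have := hpos ρ
          positivity
      · filter_upwards [ae_restrict_mem measurableSet_Ioi] with y (hy : 0 < y)
        have hp := hpos ρ
        rw [Real.norm_of_nonneg (by positivity), mul_left_comm, ← mul_inv, ← mul_pow]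
        have hm : min 1 ‖x - (ρ : ℂ)‖ * (1 + y) ≤ ‖x - ρ‖ + y := by
          have h3 := min_le_left 1 ‖x - (ρ : ℂ)‖
          have h4 := min_le_right 1 ‖x - (ρ : ℂ)‖
          nlinarith
        have : 0 < min 1 ‖x - (ρ : ℂ)‖ := lt_min one_pos hp
        gcongr
    calc ∫ y in Ioi (0 : ℝ), ‖F ρ y‖
        ≤ ∫ y in Ioi (0 : ℝ), (analyticOrderNatAt f (ρ : ℂ) : ℝ) *
            ((δ ^ 2)⁻¹ * (y ^ (1 - s.re) * ((‖x - ρ‖ + y) ^ 2)⁻¹)) := by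
          refine setIntegral_mono_on (hFint ρ).norm ((hint.const_mul _).const_mul _)
            measurableSet_Ioi fun y (hy : 0 < y) => ?_
          rw [hF]
          simp only [norm_mul, norm_natCast]
          gcongr
          have := norm_cpow_smul_inv_sq_le (u := 2 - s) hδ (hpos ρ) hy (hsec ρ ρ.2 y hy.le)
          rwa [hre1] at this
      _ = _ := by
          rw [integral_const_mul, integral_const_mul, integral_rpow_mul_inv_add_sq _ (hpos ρ)]
          ring
  have key := hasSum_integral_of_summable_integral_norm hFint hFsum
  have e1 : (fun ρ : {z : ℂ // f z = 0} =>
      (analyticOrderNatAt f (ρ : ℂ) : ℂ) * (x - ρ) ^ (-s) * (Gamma (2 - s) * Gamma s)) =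
      fun ρ => ∫ y in Ioi (0 : ℝ), F ρ y := by
    funext ρ
    rw [hF]
    simp only
    rw [integral_const_mul]
    have := mellin_inv_add_sq (hx ρ ρ.2) hu0 hu2
    rw [mellin] at this
    rw [this]
    ring_nf
  have e2 : mellin (fun y : ℝ => -deriv (logDeriv f) (x + y)) (2 - s) =
      ∫ y in Ioi (0 : ℝ), ∑' ρ, F ρ y := by
    refine setIntegral_congr_fun measurableSet_Ioi fun y (hy : 0 < y) => ?_
    have hs := (hf.hasSum_deriv_logDeriv (hx.apply_add_ne_zero hy.le)).const_smul
      ((y : ℂ) ^ (2 - s - 1))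
    rw [← hs.tsum_eq]
    refine tsum_congr fun ρ => ?_
    simp only [hF, smul_eq_mul]
    rw [show x + (y : ℂ) - ρ = x - ρ + y by ring]
    ring
  rw [e1, e2]
  exact key

/-- The term bound behind absolute convergence, uniform on vertical strips. -/
lemma norm_cpow_neg_le {a s : ℂ} (ha : a ≠ 0) {σ₀ σ₁ T : ℝ} (h0 : σ₀ ≤ s.re) (h1 : s.re ≤ σ₁)
    (hT : |s.im| ≤ T) :
    ‖a ^ (-s)‖ ≤ Real.exp (Real.pi * T) * (‖a‖ ^ (-σ₀) + ‖a‖ ^ (-σ₁)) := by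
  have hpos : 0 < ‖a‖ := norm_pos_iff.2 ha
  rw [norm_cpow_of_ne_zero ha, div_eq_mul_inv, ← Real.exp_neg, mul_comm]
  simp only [neg_re, neg_im, mul_neg, neg_neg]
  refine mul_le_mul (Real.exp_le_exp.2 ?_) ?_ (by positivity) (by positivity)
  · calc arg a * s.im ≤ |arg a * s.im| := le_abs_self _
      _ = |arg a| * |s.im| := abs_mul _ _
      _ ≤ _ := by
        have := abs_arg_le_pi a
        gcongr
  · rcases le_total 1 ‖a‖ with h | h
    · have : ‖a‖ ^ (-s.re) ≤ ‖a‖ ^ (-σ₀) := Real.rpow_le_rpow_of_exponent_le h (by linarith)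
      have : 0 ≤ ‖a‖ ^ (-σ₁) := by positivity
      linarith
    · have : ‖a‖ ^ (-s.re) ≤ ‖a‖ ^ (-σ₁) :=
        Real.rpow_le_rpow_of_exponent_ge hpos h (by linarith)
      have : 0 ≤ ‖a‖ ^ (-σ₀) := by positivity
      linarith

lemma IsEntireOfOrder.summable_cpow {f : ℂ → ℂ} (hf : IsEntireOfOrder f 1) {x : ℂ}
    (hx : IsEligible f x) {s : ℂ} (hs : 1 < s.re) :
    Summable fun ρ : {z : ℂ // f z = 0} =>
      (analyticOrderNatAt f (ρ : ℂ) : ℂ) * (x - ρ) ^ (-s) := by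
  have h := hf.summable_norm_sub hx.apply_ne_zero hs
  refine Summable.of_norm_bounded ((h.add h).mul_left (Real.exp (Real.pi * |s.im|))) fun ρ => ?_
  have := norm_cpow_neg_le (slitPlane_ne_zero (hx ρ ρ.2)) (s := s) le_rfl le_rfl le_rfl
  rw [norm_mul, norm_natCast]
  calc _ ≤ (analyticOrderNatAt f (ρ : ℂ) : ℝ) * (Real.exp (Real.pi * |s.im|) *
        (‖x - ρ‖ ^ (-s.re) + ‖x - ρ‖ ^ (-s.re))) := by gcongr
    _ = _ := by ring

lemma IsEntireOfOrder.differentiableOn_tsum_cpow {f : ℂ → ℂ} (hf : IsEntireOfOrder f 1) {x : ℂ}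
    (hx : IsEligible f x) :
    DifferentiableOn ℂ (fun s => ∑' ρ : {z : ℂ // f z = 0},
      (analyticOrderNatAt f (ρ : ℂ) : ℂ) * (x - ρ) ^ (-s)) {s : ℂ | 1 < s.re} := by
  intro s (hs : 1 < s.re)
  obtain ⟨σ₀, h0, h0s⟩ := exists_between hs
  set U : Set ℂ := {w | σ₀ < w.re ∧ w.re < s.re + 1 ∧ |w.im| < |s.im| + 1} with hU
  have hUo : IsOpen U := (isOpen_lt continuous_const continuous_re).inter
    ((isOpen_lt continuous_re continuous_const).inter
      (isOpen_lt continuous_im.abs continuous_const))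
  have hsU : s ∈ U := ⟨h0s, by linarith, by linarith⟩
  have hsum := ((hf.summable_norm_sub hx.apply_ne_zero h0).add
    (hf.summable_norm_sub hx.apply_ne_zero (σ := s.re + 1) (by linarith))).mul_left
      (Real.exp (Real.pi * (|s.im| + 1)))
  have := differentiableOn_tsum_of_summable_norm hsum
    (F := fun (ρ : {z : ℂ // f z = 0}) s => (analyticOrderNatAt f (ρ : ℂ) : ℂ) * (x - ρ) ^ (-s))
    (fun ρ w _ => ?_) hUo fun ρ w hw => ?_
  · exact (this.differentiableAt (hUo.mem_nhds hsU)).differentiableWithinAt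
  · exact ((differentiableAt_id.neg.const_cpow
      (Or.inl (slitPlane_ne_zero (hx ρ ρ.2)))).const_mul _).differentiableWithinAt
  · have := norm_cpow_neg_le (slitPlane_ne_zero (hx ρ ρ.2)) hw.1.le hw.2.1.le hw.2.2.le
    rw [norm_mul, norm_natCast]
    refine (mul_le_mul_of_nonneg_left this (by positivity)).trans (le_of_eq ?_)
    ring

/-- The integral representation of the zeta function over zeros in the strip `1 < Re s < 2`. -/
theorem IsEntireOfOrder.one_sub_mul_tsum_eq {f : ℂ → ℂ} (hf : IsEntireOfOrder f 1)
    (hre : ∀ ρ, f ρ = 0 → ρ.re ≤ 1) {x : ℂ} (hx : IsEligible f x) {s : ℂ} (h1 : 1 < s.re)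
    (h2 : s.re < 2) :
    (1 - s) * ∑' ρ : {z : ℂ // f z = 0},
      (analyticOrderNatAt f (ρ : ℂ) : ℂ) * (x - ρ) ^ (-s) =
    sin ((Real.pi : ℂ) * s) / (Real.pi : ℂ) *
      mellin (fun y : ℝ => -deriv (logDeriv f) (x + y)) (2 - s) := by
  rw [← (hf.hasSum_mellin hre hx h1 h2).tsum_eq, tsum_mul_right,
    ← sin_div_pi_mul_Gamma_mul_Gamma (by linarith) h2 (fun h => by simp [h] at h1)]
  ring

/-! ### Analytic continuation -/

/-- `g` has an asymptotic expansion in powers `y⁻¹, y⁻², …` as `y → +∞`.  The approximation of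
order `N` is any polynomial in `y⁻¹` without constant term; the coefficients are not required to
be the same for different `N`, which makes stability under products immediate. -/
def HasInvPowExpansion (g : ℝ → ℂ) : Prop :=
  ∀ N : ℕ, ∃ P : Polynomial ℂ,
    (fun y : ℝ => g y - (y : ℂ)⁻¹ * P.eval (y : ℂ)⁻¹) =O[atTop] fun y : ℝ => y⁻¹ ^ N

lemma inv_pow_isBigO_rpow (N : ℕ) :
    (fun y : ℝ => y⁻¹ ^ N) =O[atTop] fun y : ℝ => y ^ (-(N : ℝ)) := by
  refine EventuallyEq.isBigO ?_
  filter_upwards [eventually_gt_atTop 0] with y hy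
  rw [Real.rpow_neg hy.le, Real.rpow_natCast, inv_pow]

lemma isBigO_one_nhdsGT_zero {g : ℝ → ℂ} (hg : ContinuousOn g (Ici 0)) :
    g =O[nhdsWithin 0 (Ioi 0)] fun y : ℝ => y ^ (-(0 : ℝ)) := by
  simp only [neg_zero, Real.rpow_zero]
  exact (((hg 0 self_mem_Ici).mono Ioi_subset_Ici_self).tendsto.isBigO_one ℝ)

/-- The Mellin transform of a power of `y⁻¹` restricted to `y > 1`. -/
lemma hasMellin_indicator_inv_pow (k : ℕ) {u : ℂ} (hu : u.re < k + 1) :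
    HasMellin (indicator (Ioi 1) fun y : ℝ => (y : ℂ)⁻¹ * (y : ℂ)⁻¹ ^ k) u
      (k + 1 - u)⁻¹ := by
  have hsub : Ioi (1 : ℝ) ⊆ Ioi 0 := Ioi_subset_Ioi zero_le_one
  have hre : (u - 1 - (k + 1)).re < -1 := by simp; linarith
  have hcongr : ∀ y ∈ Ioi (1 : ℝ),
      (y : ℂ) ^ (u - 1) • ((y : ℂ)⁻¹ * (y : ℂ)⁻¹ ^ k) = (y : ℂ) ^ (u - 1 - (k + 1)) := by
    intro y (hy : 1 < y)
    have hy0 : (y : ℂ) ≠ 0 := by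
      have : y ≠ 0 := by linarith
      exact_mod_cast this
    rw [cpow_sub (u - 1) _ hy0, smul_eq_mul, ← pow_succ', inv_pow, div_eq_mul_inv]
    congr 2
    rw [← cpow_natCast]
    push_cast
    rfl
  simp_rw [HasMellin, mellin, MellinConvergent, ← indicator_smul, IntegrableOn,
    integrable_indicator_iff measurableSet_Ioi, integral_indicator measurableSet_Ioi, IntegrableOn,
    Measure.restrict_restrict_of_subset hsub]
  rw [← IntegrableOn]
  refine ⟨?_, ?_⟩
  · exact (integrableOn_Ioi_cpow_of_lt hre one_pos).congr_fun
      (fun y hy => (hcongr y hy).symm) measurableSet_Ioi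
  · rw [setIntegral_congr_fun measurableSet_Ioi hcongr, integral_Ioi_cpow_of_lt hre one_pos,
      ofReal_one, one_cpow, ← one_div, ← neg_div_neg_eq, neg_neg]
    congr 1
    ring

/-- `sin (π s) / π` divided by its zero at an integer is entire. -/
lemma exists_entire_sin_div (n : ℤ) : ∃ E : ℂ → ℂ, Differentiable ℂ E ∧
    ∀ s : ℂ, s ≠ n → E s = sin ((Real.pi : ℂ) * s) / (Real.pi : ℂ) * (s - n)⁻¹ := by
  refine ⟨dslope (fun s : ℂ => sin ((Real.pi : ℂ) * s) / (Real.pi : ℂ)) n, ?_, fun s hs => ?_⟩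
  · rw [← differentiableOn_univ, differentiableOn_dslope univ_mem]
    fun_prop
  · rw [dslope_of_ne _ hs, slope_def_field]
    have : sin ((Real.pi : ℂ) * n) = 0 := by rw [mul_comm]; exact sin_int_mul_pi n
    rw [this, zero_div, sub_zero, div_eq_mul_inv]

/-- Continuation of a Mellin transform to a wider strip, from an asymptotic expansion.  Its poles
are simple and lie at integers, where the factor `sin (π s)` cancels them. -/
theorem HasInvPowExpansion.exists_continuation {g : ℝ → ℂ} (hg : ContinuousOn g (Ici 0))
    (hexp : HasInvPowExpansion g) (N : ℕ) :
    ∃ A : ℂ → ℂ, DifferentiableOn ℂ A {s : ℂ | -(N : ℝ) < s.re ∧ s.re < 2} ∧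
      ∀ s : ℂ, 1 < s.re → s.re < 2 →
        A s = sin ((Real.pi : ℂ) * s) / (Real.pi : ℂ) * mellin g (2 - s) := by
  -- the approximation is subtracted for `y > 1` only, so that the behaviour at `0` is not affected
  obtain ⟨P, hP⟩ := hexp (N + 2)
  choose E hEd hE using fun k : ℕ => exists_entire_sin_div (1 - (k : ℤ))
  set Q : ℝ → ℂ := indicator (Ioi 1) fun y : ℝ => (y : ℂ)⁻¹ * P.eval (y : ℂ)⁻¹ with hQ
  have hQcont : ContinuousOn (fun y : ℝ => (y : ℂ)⁻¹ * P.eval (y : ℂ)⁻¹) (Ioi 0) := by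
    have hinv : ContinuousOn (fun y : ℝ => (y : ℂ)⁻¹) (Ioi 0) :=
      ContinuousOn.inv₀ (by fun_prop) fun y hy => by exact_mod_cast ne_of_gt hy
    exact hinv.mul (P.continuous.comp_continuousOn hinv)
  have hQloc : LocallyIntegrableOn Q (Ioi 0) := by
    intro y hy
    obtain ⟨t, ht, hi⟩ := hQcont.locallyIntegrableOn (μ := volume) measurableSet_Ioi y hy
    exact ⟨t, ht, hi.indicator measurableSet_Ioi⟩
  have hgloc : LocallyIntegrableOn g (Ioi 0) :=
    (hg.mono Ioi_subset_Ici_self).locallyIntegrableOn measurableSet_Ioi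
  have hRloc : LocallyIntegrableOn (fun y => g y - Q y) (Ioi 0) := hgloc.sub hQloc
  have hRtop : (fun y => g y - Q y) =O[atTop] fun y : ℝ => y ^ (-((N + 2 : ℕ) : ℝ)) := by
    refine (IsBigO.congr' hP ?_ EventuallyEq.rfl).trans (inv_pow_isBigO_rpow _)
    filter_upwards [eventually_gt_atTop 1] with y hy
    rw [hQ, indicator_of_mem (show y ∈ Ioi 1 from hy)]
  have hRbot : (fun y => g y - Q y) =O[nhdsWithin 0 (Ioi 0)] fun y : ℝ => y ^ (-(0 : ℝ)) := by
    refine IsBigO.congr' (isBigO_one_nhdsGT_zero hg) ?_ EventuallyEq.rfl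
    filter_upwards [nhdsWithin_le_nhds (Iio_mem_nhds one_pos)] with y (hy : y < 1)
    rw [hQ, indicator_of_notMem (by simpa using hy.le), sub_zero]
  refine ⟨fun s => sin ((Real.pi : ℂ) * s) / (Real.pi : ℂ) *
    mellin (fun y => g y - Q y) (2 - s) + ∑ k ∈ P.support, P.coeff k * E k s, ?_, ?_⟩
  · rintro s ⟨hs1, hs2⟩
    have hm : DifferentiableAt ℂ (mellin fun y => g y - Q y) (2 - s) :=
      mellin_differentiableAt_of_isBigO_rpow hRloc hRtop
        (by push_cast; simp; linarith) hRbot (by simpa using hs2)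
    have hm' : DifferentiableAt ℂ (fun s => mellin (fun y => g y - Q y) (2 - s)) s :=
      DifferentiableAt.comp (g := mellin fun y => g y - Q y) s hm (by fun_prop)
    have hEs : DifferentiableAt ℂ (fun s => ∑ k ∈ P.support, P.coeff k * E k s) s :=
      DifferentiableAt.fun_sum fun k _ => ((hEd k) s).const_mul _
    have hsin : DifferentiableAt ℂ (fun s => sin ((Real.pi : ℂ) * s) / (Real.pi : ℂ)) s := by
      fun_prop
    exact ((hsin.mul hm').add hEs).differentiableWithinAt
  · intro s hs1 hs2
    have hRm : MellinConvergent (fun y => g y - Q y) (2 - s) :=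
      mellinConvergent_of_isBigO_rpow hRloc hRtop
        (by push_cast; simp; linarith [(Nat.cast_nonneg N : (0 : ℝ) ≤ N)]) hRbot
        (by simpa using hs2)
    have hQsum : Q = fun y => ∑ k ∈ P.support,
        P.coeff k • (indicator (Ioi 1) fun y : ℝ => (y : ℂ)⁻¹ * (y : ℂ)⁻¹ ^ k) y := by
      funext y
      by_cases hy : y ∈ Ioi (1 : ℝ)
      · simp only [hQ, indicator_of_mem hy, smul_eq_mul]
        rw [Polynomial.eval_eq_sum, Polynomial.sum, Finset.mul_sum]
        exact Finset.sum_congr rfl fun k _ => by ring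
      · simp only [hQ, indicator_of_notMem hy, smul_zero, Finset.sum_const_zero]
    have hbase : ∀ k : ℕ, HasMellin (indicator (Ioi 1) fun y : ℝ => (y : ℂ)⁻¹ * (y : ℂ)⁻¹ ^ k)
        (2 - s) (k + 1 - (2 - s))⁻¹ := fun k => hasMellin_indicator_inv_pow k (by
      simp; linarith [(Nat.cast_nonneg k : (0 : ℝ) ≤ k)])
    have hQm : HasMellin Q (2 - s) (∑ k ∈ P.support, P.coeff k * (k + 1 - (2 - s))⁻¹) := by
      have hterm : ∀ k ∈ P.support, IntegrableOn (fun y : ℝ => (y : ℂ) ^ (2 - s - 1) •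
          (P.coeff k • (indicator (Ioi 1) fun y : ℝ => (y : ℂ)⁻¹ * (y : ℂ)⁻¹ ^ k) y))
          (Ioi 0) := fun k _ => (hbase k).1.const_smul (P.coeff k)
      rw [hQsum]
      refine ⟨?_, ?_⟩
      · unfold MellinConvergent
        simp_rw [Finset.smul_sum]
        exact integrable_finsetSum _ hterm
      · unfold mellin
        simp_rw [Finset.smul_sum]
        rw [integral_finsetSum _ hterm]
        refine Finset.sum_congr rfl fun k _ => ?_
        rw [← (hbase k).2]
        exact mellin_const_smul _ _ _
    have hg' : g = fun y => (g y - Q y) + Q y := by funext y; ring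
    have hadd := (hasMellin_add hRm hQm.1).2
    rw [← hg'] at hadd
    rw [hadd, hQm.2, mul_add, Finset.mul_sum]
    refine congrArg₂ (· + ·) rfl ?_
    refine Finset.sum_congr rfl fun k _ => ?_
    rw [hE k s (fun h => by
      rw [h] at hs1
      simp at hs1
      linarith [(Nat.cast_nonneg k : (0 : ℝ) ≤ k)])]
    push_cast
    rw [show s - (1 - (k : ℂ)) = k + 1 - (2 - s) by ring]
    ring

lemma isPreconnected_re_gt (a : ℝ) : IsPreconnected {s : ℂ | a < s.re} :=
  (convex_halfSpace_re_gt a).isPreconnected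

/-- Two holomorphic functions on a vertical strip that agree on a substrip are equal. -/
lemma eqOn_of_eqOn_substrip {U : Set ℂ} (hU : IsOpen U) (hUc : IsPreconnected U) {A B : ℂ → ℂ}
    (hA : DifferentiableOn ℂ A U) (hB : DifferentiableOn ℂ B U) {a b : ℝ} (hab : a < b)
    (hsub : ∀ s : ℂ, a < s.re → s.re < b → s ∈ U)
    (h : ∀ s : ℂ, a < s.re → s.re < b → A s = B s) : EqOn A B U := by
  obtain ⟨t, hat, htb⟩ := exists_between hab
  refine (hA.analyticOnNhd hU).eqOn_of_preconnected_of_eventuallyEq (hB.analyticOnNhd hU) hUc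
    (z₀ := t) (hsub t hat htb) ?_
  have hopen : IsOpen {s : ℂ | a < s.re ∧ s.re < b} :=
    (isOpen_re_gt a).inter (isOpen_lt continuous_re continuous_const)
  filter_upwards [hopen.mem_nhds (show (t : ℂ) ∈ {s : ℂ | a < s.re ∧ s.re < b} from ⟨hat, htb⟩)]
    with s hs
  exact h s hs.1 hs.2

/-- A function on `Re s > 1` with continuations to arbitrarily wide strips extends to an entire
function. -/
theorem exists_entire_of_strips {h : ℂ → ℂ} (hh : DifferentiableOn ℂ h {s : ℂ | 1 < s.re})
    (H : ∀ N : ℕ, ∃ A : ℂ → ℂ, DifferentiableOn ℂ A {s : ℂ | -(N : ℝ) < s.re ∧ s.re < 2} ∧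
      ∀ s : ℂ, 1 < s.re → s.re < 2 → A s = h s) :
    ∃ J : ℂ → ℂ, Differentiable ℂ J ∧ ∀ s : ℂ, 1 < s.re → J s = h s := by
  choose A hA hAh using H
  set J : ℕ → ℂ → ℂ := fun N s => if s.re < 2 then A N s else h s with hJ
  have hJh : ∀ N s, 1 < s.re → J N s = h s := by
    intro N s hs
    simp only [hJ]
    split_ifs with h2
    · exact hAh N s hs h2
    · rfl
  have hJd : ∀ N, DifferentiableOn ℂ (J N) {s : ℂ | -(N : ℝ) < s.re} := by
    intro N s (hs : -(N : ℝ) < s.re)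
    refine DifferentiableAt.differentiableWithinAt ?_
    rcases lt_or_ge s.re 2 with h2 | h2
    · have hopen : IsOpen {s : ℂ | -(N : ℝ) < s.re ∧ s.re < 2} :=
        (isOpen_re_gt _).inter (isOpen_lt continuous_re continuous_const)
      have hmem : {s : ℂ | -(N : ℝ) < s.re ∧ s.re < 2} ∈ nhds s := hopen.mem_nhds ⟨hs, h2⟩
      refine ((hA N).differentiableAt hmem).congr_of_eventuallyEq ?_
      filter_upwards [hmem] with w hw
      simp only [hJ, if_pos hw.2]
    · have hmem : {s : ℂ | 1 < s.re} ∈ nhds s :=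
        (isOpen_re_gt _).mem_nhds (show 1 < s.re by linarith)
      refine (hh.differentiableAt hmem).congr_of_eventuallyEq ?_
      filter_upwards [hmem] with w hw
      exact hJh N w hw
  have hJJ : ∀ N M : ℕ, N ≤ M → ∀ s : ℂ, -(N : ℝ) < s.re → J N s = J M s := by
    intro N M hNM s hs
    have hNM' : (N : ℝ) ≤ M := by exact_mod_cast hNM
    have hN0 : (0 : ℝ) ≤ N := Nat.cast_nonneg N
    refine eqOn_of_eqOn_substrip (isOpen_re_gt (-(N : ℝ))) (isPreconnected_re_gt _) (hJd N)
      ((hJd M).mono fun w (hw : -(N : ℝ) < w.re) => show -(M : ℝ) < w.re by linarith)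
      (a := 1) (b := 2) (by norm_num) (fun w hw _ => show -(N : ℝ) < w.re by linarith)
      (fun w hw _ => ?_) hs
    rw [hJh N w hw, hJh M w hw]
  have hJeq : ∀ N M : ℕ, ∀ s : ℂ, -(N : ℝ) < s.re → -(M : ℝ) < s.re → J N s = J M s := by
    intro N M s hN hM
    rcases le_total N M with h | h
    · exact hJJ N M h s hN
    · exact (hJJ M N h s hM).symm
  have hceil : ∀ s : ℂ, -((⌈|s.re|⌉₊ + 1 : ℕ) : ℝ) < s.re := by
    intro s
    have h1 := Nat.le_ceil |s.re|
    have h2 := neg_abs_le s.re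
    push_cast
    linarith
  refine ⟨fun s => J (⌈|s.re|⌉₊ + 1) s, fun s => ?_, fun s hs => hJh _ s hs⟩
  have hmem := (isOpen_re_gt (-((⌈|s.re|⌉₊ + 1 : ℕ) : ℝ))).mem_nhds (hceil s)
  refine ((hJd (⌈|s.re|⌉₊ + 1)).differentiableAt hmem).congr_of_eventuallyEq ?_
  filter_upwards [hmem] with w hw
  exact hJeq _ _ w (hceil w) hw

/-- `J` is the entire continuation of `(1 - s) * ∑ (x - ρ) ^ (-s)`, the sum running over the zeros
`ρ` of `f` with multiplicity.  The factor `1 - s` removes the possible pole at `s = 1`, so that the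
identity theorem applies on connected domains containing `1`. -/
def IsEntireZeta (f : ℂ → ℂ) (x : ℂ) (J : ℂ → ℂ) : Prop :=
  Differentiable ℂ J ∧ ∀ s : ℂ, 1 < s.re → J s = (1 - s) * ∑' ρ : {z : ℂ // f z = 0},
    (analyticOrderNatAt f (ρ : ℂ) : ℂ) * (x - ρ) ^ (-s)

/-- The zeta function over zeros continues whenever the second logarithmic derivative has an
expansion on the ray. -/
theorem IsEntireOfOrder.exists_isEntireZeta {f : ℂ → ℂ} (hf : IsEntireOfOrder f 1)
    (hre : ∀ ρ, f ρ = 0 → ρ.re ≤ 1) {x : ℂ} (hx : IsEligible f x)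
    (hg : ContinuousOn (fun y : ℝ => -deriv (logDeriv f) (x + y)) (Ici 0))
    (hexp : HasInvPowExpansion fun y : ℝ => -deriv (logDeriv f) (x + y)) :
    ∃ J, IsEntireZeta f x J := by
  refine exists_entire_of_strips
    (DifferentiableOn.mul (by fun_prop) (hf.differentiableOn_tsum_cpow hx)) fun N => ?_
  obtain ⟨A, hA, hAeq⟩ := hexp.exists_continuation hg N
  refine ⟨A, hA, fun s h1 h2 => ?_⟩
  rw [hAeq s h1 h2, ← hf.one_sub_mul_tsum_eq hre hx h1 h2]

lemma IsEntireZeta.isZetaOverZeros {f : ℂ → ℂ} (hf : IsEntireOfOrder f 1) {x : ℂ}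
    (hx : IsEligible f x) {J : ℂ → ℂ} (hJ : IsEntireZeta f x J) :
    IsZetaOverZeros f x fun s => J s / (1 - s) where
  hasSum s hs := by
    have hne : 1 - s ≠ 0 := sub_ne_zero.2 fun h => by rw [← h] at hs; simp at hs
    rw [hJ.2 s hs, mul_div_cancel_left₀ _ hne]
    exact (hf.summable_cpow hx hs).hasSum
  analytic s hs := (hJ.1.analyticAt s).fun_div (by fun_prop) (sub_ne_zero.2 hs.symm)
  meromorphic := (hJ.1.analyticAt 1).meromorphicAt.fun_div
    (AnalyticAt.meromorphicAt (by fun_prop))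

/-! ### Asymptotic expansions on horizontal rays -/

lemma inv_pow_isBigO_inv_pow {M K : ℕ} (h : M ≤ K) :
    (fun y : ℝ => y⁻¹ ^ K) =O[atTop] fun y : ℝ => y⁻¹ ^ M := by
  refine IsBigO.of_bound 1 ?_
  filter_upwards [eventually_ge_atTop 1] with y hy
  have h0 : 0 ≤ y⁻¹ := by positivity
  rw [one_mul, Real.norm_of_nonneg (by positivity), Real.norm_of_nonneg (by positivity)]
  exact pow_le_pow_of_le_one h0 (inv_le_one_of_one_le₀ hy) h

lemma isBigO_inv_pow_of_zpow {g : ℝ → ℂ} {n : ℤ} {M : ℕ} (hn : (M : ℤ) ≤ n)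
    (hg : g =O[atTop] fun t : ℝ => t ^ (-n)) : g =O[atTop] fun t : ℝ => t⁻¹ ^ M := by
  obtain ⟨K, rfl⟩ := Int.eq_ofNat_of_zero_le (le_trans (Int.natCast_nonneg M) hn)
  refine IsBigO.trans ?_ (inv_pow_isBigO_inv_pow (M := M) (K := K) (by exact_mod_cast hn))
  simpa [inv_pow] using hg

/-- Transfer of a decay estimate from the real axis to a horizontal ray: if all derivatives of `D`
decay at real `t → +∞` and `D` has polynomial growth on the discs of radius `t / 4` about `t`, then
`D (x + t)` decays too, by Taylor's formula about `t` with Cauchy's estimates for the tail. -/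
theorem isBigO_shift {D : ℂ → ℂ} {p M : ℕ} {C : ℝ}
    (hD : ∀ᶠ t : ℝ in atTop, ∀ z ∈ Metric.ball (t : ℂ) (t / 4),
      DifferentiableAt ℂ D z ∧ ‖D z‖ ≤ C * t ^ p)
    (hder : ∀ j : ℕ, (fun t : ℝ => iteratedDeriv j D (t : ℂ)) =O[atTop] fun t : ℝ => t⁻¹ ^ M)
    (x : ℂ) : (fun t : ℝ => D (x + t)) =O[atTop] fun t : ℝ => t⁻¹ ^ M := by
  -- the extra `p` Taylor terms absorb the polynomial growth
  set K := M + p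
  have hmain : (fun t : ℝ => ∑ j ∈ Finset.range K,
      ((j.factorial : ℂ)⁻¹ * iteratedDeriv j D (t : ℂ) * x ^ j)) =O[atTop]
      fun t : ℝ => t⁻¹ ^ M := by
    refine IsBigO.fun_sum fun j _ => ?_
    have := (hder j).const_mul_left ((j.factorial : ℂ)⁻¹ * x ^ j)
    refine this.congr_left fun t => by ring
  have htail : (fun t : ℝ => D (x + t) - ∑ j ∈ Finset.range K,
      ((j.factorial : ℂ)⁻¹ * iteratedDeriv j D (t : ℂ) * x ^ j)) =O[atTop]
      fun t : ℝ => t⁻¹ ^ M := by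
    refine IsBigO.of_bound (2 * C * (8 * ‖x‖) ^ K) ?_
    filter_upwards [hD, eventually_ge_atTop (16 * ‖x‖ + 1)] with t hDt ht
    have hx0 := norm_nonneg x
    have ht0 : 0 < t := by linarith
    have hC0 : 0 ≤ C * t ^ p := (norm_nonneg _).trans
      (hDt t (Metric.mem_ball_self (by positivity))).2
    have hcau : ∀ j : ℕ, ‖iteratedDeriv j D (t : ℂ)‖ ≤
        j.factorial * (C * t ^ p) / (t / 8) ^ j := by
      intro j
      have hsub : Metric.closedBall (t : ℂ) (t / 8) ⊆ Metric.ball (t : ℂ) (t / 4) :=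
        Metric.closedBall_subset_ball (by linarith)
      refine norm_iteratedDeriv_le_of_forall_mem_sphere_norm_le j (by positivity)
        (DifferentiableOn.diffContOnCl fun z hz => ?_) fun z hz => ?_
      · exact (hDt z (hsub (Metric.closure_ball_subset_closedBall hz))).1.differentiableWithinAt
      · exact (hDt z (hsub (Metric.sphere_subset_closedBall hz))).2
    set r : ℝ := 8 * ‖x‖ / t with hr
    have hr0 : 0 ≤ r := by positivity
    have hr2 : r ≤ 1 / 2 := by
      rw [hr, div_le_iff₀ ht0]
      linarith
    have hterm : ∀ j : ℕ, ‖(j.factorial : ℂ)⁻¹ * iteratedDeriv j D (t : ℂ) * x ^ j‖ ≤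
        C * t ^ p * r ^ j := by
      intro j
      have hf : (0 : ℝ) < j.factorial := by exact_mod_cast j.factorial_pos
      rw [norm_mul, norm_mul, norm_inv, norm_natCast, norm_pow]
      calc _ ≤ (j.factorial : ℝ)⁻¹ * (j.factorial * (C * t ^ p) / (t / 8) ^ j) * ‖x‖ ^ j := by
            gcongr
            exact hcau j
        _ = _ := by
            rw [hr, div_pow (8 * ‖x‖), div_pow t, mul_pow]
            field_simp
    have hmem : x + t ∈ Metric.ball (t : ℂ) (t / 4) := by
      simp [dist_eq_norm]
      linarith
    have htaylor := hasSum_taylorSeries_on_ball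
      (fun z hz => (hDt z hz).1.differentiableWithinAt) hmem
    simp only [add_sub_cancel_right, smul_eq_mul] at htaylor
    have hT : HasSum (fun j : ℕ => (j.factorial : ℂ)⁻¹ * iteratedDeriv j D (t : ℂ) * x ^ j)
        (D (x + t)) := by
      refine htaylor.congr_fun fun j => ?_
      ring
    have hT' := (hasSum_nat_add_iff' K).2 hT
    have hgeo : HasSum (fun j : ℕ => C * t ^ p * r ^ (j + K))
        (C * t ^ p * (r ^ K * (1 - r)⁻¹)) := by
      have := ((hasSum_geometric_of_lt_one hr0 (by linarith)).mul_left (r ^ K)).mul_left (C * t ^ p)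
      refine this.congr_fun fun j => by ring
    have hle := hT'.norm_le_of_bounded hgeo fun j => hterm (j + K)
    refine hle.trans ?_
    have h1 : (1 - r)⁻¹ ≤ 2 := by
      rw [inv_le_comm₀ (by linarith) (by norm_num)]
      linarith
    rw [Real.norm_of_nonneg (by positivity)]
    calc C * t ^ p * (r ^ K * (1 - r)⁻¹) ≤ C * t ^ p * (r ^ K * 2) := by gcongr
      _ = _ := by
        rw [hr, div_pow, inv_pow, show t ^ K = t ^ M * t ^ p from pow_add _ _ _]
        field_simp
  refine (htail.add hmain).congr_left fun t => by ring

namespace HasInvPowExpansion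

lemma congr {g h : ℝ → ℂ} (hg : HasInvPowExpansion g) (hgh : g =ᶠ[atTop] h) :
    HasInvPowExpansion h := fun N => by
  obtain ⟨P, hP⟩ := hg N
  refine ⟨P, hP.congr' ?_ EventuallyEq.rfl⟩
  filter_upwards [hgh] with y hy
  rw [hy]

lemma add {g h : ℝ → ℂ} (hg : HasInvPowExpansion g) (hh : HasInvPowExpansion h) :
    HasInvPowExpansion fun y => g y + h y := fun N => by
  obtain ⟨P, hP⟩ := hg N
  obtain ⟨Q, hQ⟩ := hh N
  refine ⟨P + Q, (hP.add hQ).congr_left fun y => ?_⟩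
  rw [Polynomial.eval_add]
  ring

lemma const_mul {g : ℝ → ℂ} (hg : HasInvPowExpansion g) (c : ℂ) :
    HasInvPowExpansion fun y => c * g y := fun N => by
  obtain ⟨P, hP⟩ := hg N
  refine ⟨Polynomial.C c * P, (hP.const_mul_left c).congr_left fun y => ?_⟩
  rw [Polynomial.eval_mul, Polynomial.eval_C]
  ring

lemma of_isBigO {g : ℝ → ℂ} (hg : ∀ N : ℕ, g =O[atTop] fun y : ℝ => y⁻¹ ^ N) :
    HasInvPowExpansion g := fun N => ⟨0, by simpa using hg N⟩

lemma _root_.tendsto_ofReal_inv_atTop : Tendsto (fun y : ℝ => (y : ℂ)⁻¹) atTop (nhds 0) := by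
  have := (continuous_ofReal.tendsto 0).comp tendsto_inv_atTop_zero
  simpa [Function.comp_def] using this

lemma isBigO_eval_one (P : Polynomial ℂ) :
    (fun y : ℝ => (y : ℂ)⁻¹ * P.eval (y : ℂ)⁻¹) =O[atTop] fun _ : ℝ => (1 : ℝ) := by
  exact (tendsto_ofReal_inv_atTop.mul
    ((P.continuous.tendsto 0).comp tendsto_ofReal_inv_atTop)).isBigO_one ℝ

lemma isBigO_one {g : ℝ → ℂ} (hg : HasInvPowExpansion g) :
    g =O[atTop] fun _ : ℝ => (1 : ℝ) := by
  obtain ⟨P, hP⟩ := hg 0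
  simp only [pow_zero] at hP
  exact (hP.add (isBigO_eval_one P)).congr_left fun y => by ring

lemma mul {g h : ℝ → ℂ} (hg : HasInvPowExpansion g) (hh : HasInvPowExpansion h) :
    HasInvPowExpansion fun y => g y * h y := fun N => by
  obtain ⟨P, hP⟩ := hg N
  obtain ⟨Q, hQ⟩ := hh N
  refine ⟨Polynomial.X * P * Q, ?_⟩
  have h1 := hP.mul hh.isBigO_one
  have h2 := (isBigO_eval_one P).mul hQ
  simp only [mul_one, one_mul] at h1 h2
  refine (h1.add h2).congr_left fun y => ?_
  simp only [Polynomial.eval_mul, Polynomial.eval_X]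
  ring

lemma inv_add (x : ℂ) : HasInvPowExpansion fun y : ℝ => (x + y)⁻¹ := fun N => by
  refine ⟨∑ k ∈ Finset.range N, Polynomial.C ((-x) ^ k) * Polynomial.X ^ k, ?_⟩
  refine IsBigO.of_bound (‖x‖ ^ N) ?_
  filter_upwards [eventually_ge_atTop (‖x‖ + 1)] with y hy
  have hx0 := norm_nonneg x
  have hy0 : 0 < y := by linarith
  have hyc : (y : ℂ) ≠ 0 := by exact_mod_cast hy0.ne'
  have hxy : 1 ≤ ‖x + y‖ := by
    have := norm_sub_le (x + y) x
    rw [add_sub_cancel_left, norm_real, Real.norm_of_nonneg hy0.le] at this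
    linarith
  have hxyc : x + y ≠ 0 := norm_pos_iff.1 (by linarith)
  have hgeom : (∑ k ∈ Finset.range N, (-x * (y : ℂ)⁻¹) ^ k) * (x + y) =
      y * (1 - (-x * (y : ℂ)⁻¹) ^ N) := by
    rw [← geom_sum_mul_neg]
    field_simp
    ring
  have heq : (x + y)⁻¹ - (y : ℂ)⁻¹ * Polynomial.eval (y : ℂ)⁻¹
      (∑ k ∈ Finset.range N, Polynomial.C ((-x) ^ k) * Polynomial.X ^ k) =
      (-x * (y : ℂ)⁻¹) ^ N * (x + y)⁻¹ := by
    simp only [Polynomial.eval_finsetSum, Polynomial.eval_mul, Polynomial.eval_C,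
      Polynomial.eval_pow, Polynomial.eval_X, ← mul_pow]
    rw [eq_div_of_mul_eq hxyc hgeom]
    field_simp
    ring
  rw [heq, norm_mul, norm_pow, norm_mul, norm_neg, norm_inv, norm_inv, norm_real, norm_pow,
    norm_inv, mul_pow]
  exact mul_le_of_le_one_right (by positivity) (inv_le_one_of_one_le₀ hxy)

lemma mul_eval {g : ℝ → ℂ} (hg : HasInvPowExpansion g) (Q : Polynomial ℂ) :
    HasInvPowExpansion fun y => g y * Q.eval (g y) := by
  induction Q using Polynomial.induction_on' with
  | add P Q hP hQ =>
    refine (hP.add hQ).congr (Eventually.of_forall fun y => ?_)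
    simp only [Polynomial.eval_add]
    ring
  | monomial n c =>
    have hpow : HasInvPowExpansion fun y => g y * g y ^ n := by
      induction n with
      | zero => simpa using hg
      | succ n ih =>
        refine (ih.mul hg).congr (Eventually.of_forall fun y => ?_)
        simp only
        ring
    refine (hpow.const_mul c).congr (Eventually.of_forall fun y => ?_)
    simp only [Polynomial.eval_monomial]
    ring

/-- It suffices to approximate by functions that have an expansion. -/
lemma of_approx {g : ℝ → ℂ} (h : ∀ N : ℕ, ∃ k : ℝ → ℂ, HasInvPowExpansion k ∧
    (fun y => g y - k y) =O[atTop] fun y : ℝ => y⁻¹ ^ N) : HasInvPowExpansion g := fun N => by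
  obtain ⟨k, hk, hgk⟩ := h N
  obtain ⟨P, hP⟩ := hk N
  exact ⟨P, (hgk.add hP).congr_left fun y => by ring⟩

end HasInvPowExpansion

/-- The second logarithmic derivative is bounded on the discs of radius `t / 4` about `t ≥ 2`. -/
lemma IsEntireOfOrder.exists_norm_deriv_logDeriv_le {f : ℂ → ℂ} (hf : IsEntireOfOrder f 1)
    (hre : ∀ ρ, f ρ = 0 → ρ.re ≤ 1) :
    ∃ C, ∀ t : ℝ, 2 ≤ t → ∀ z ∈ Metric.ball (t : ℂ) (t / 4),
      ‖deriv (logDeriv f) z‖ ≤ C := by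
  have h2 : f 2 ≠ 0 := fun h => by have := hre 2 h; norm_num at this
  have hS := (hf.summable_norm_sub h2 (σ := 2) (by norm_num)).mul_left 4
  refine ⟨∑' ρ : {z : ℂ // f z = 0},
    4 * ((analyticOrderNatAt f (ρ : ℂ) : ℝ) * ‖2 - (ρ : ℂ)‖ ^ (-2 : ℝ)), fun t ht z hz => ?_⟩
  have hz' : ‖(t : ℂ) - z‖ < t / 4 := by
    rw [norm_sub_rev]
    simpa [dist_eq_norm] using hz
  have hzre : 1 < z.re := by
    have h := (abs_re_le_norm ((t : ℂ) - z)).trans_lt hz'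
    rw [abs_lt] at h
    simp at h
    linarith
  have hfz : f z ≠ 0 := fun h => by linarith [hre z h]
  have hsum := hf.hasSum_deriv_logDeriv hfz
  rw [← norm_neg]
  refine hsum.norm_le_of_bounded hS.hasSum fun ρ => ?_
  have hρ := hre ρ ρ.2
  have h3 : ‖(2 : ℂ) - ρ‖ ≤ ‖(t : ℂ) - ρ‖ := by
    rw [← sq_le_sq₀ (norm_nonneg _) (norm_nonneg _), Complex.sq_norm, Complex.sq_norm,
      normSq_apply, normSq_apply]
    simp
    nlinarith
  have h4 : t / 2 ≤ ‖(t : ℂ) - ρ‖ := by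
    have := re_le_norm ((t : ℂ) - ρ)
    simp at this
    linarith
  have h5 : ‖(t : ℂ) - ρ‖ ≤ ‖(t : ℂ) - z‖ + ‖z - ρ‖ := by
    simpa using norm_add_le ((t : ℂ) - z) (z - ρ)
  have h6 : 0 < ‖(2 : ℂ) - ρ‖ := norm_pos_iff.2 (sub_ne_zero.2 fun h => h2 (h ▸ ρ.2))
  have h7 : ‖(2 : ℂ) - ρ‖ / 2 ≤ ‖z - ρ‖ := by linarith
  rw [norm_mul, norm_natCast, norm_inv, norm_pow, Real.rpow_neg (norm_nonneg _), Real.rpow_two]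
  calc _ ≤ (analyticOrderNatAt f (ρ : ℂ) : ℝ) * ((‖(2 : ℂ) - ρ‖ / 2) ^ 2)⁻¹ := by gcongr
    _ = _ := by
      field_simp
      norm_num

/-! ### Primary functions -/

lemma Differentiable.analyticAt_logDeriv {f : ℂ → ℂ} (hf : Differentiable ℂ f) {z : ℂ}
    (hz : f z ≠ 0) : AnalyticAt ℂ (logDeriv f) z :=
  (hf.analyticAt z).deriv.div (hf.analyticAt z) hz

lemma three_quarters_lt_re_of_mem_ball {t : ℝ} {z : ℂ} (hz : z ∈ Metric.ball (t : ℂ) (t / 4)) :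
    3 * t / 4 < z.re := by
  have hz' : ‖(t : ℂ) - z‖ < t / 4 := by
    rw [norm_sub_rev]
    simpa [dist_eq_norm] using hz
  have h := (abs_re_le_norm ((t : ℂ) - z)).trans_lt hz'
  rw [abs_lt] at h
  simp at h
  linarith

/-- The second derivative of the remainder in the Stirling expansion compares the second logarithmic
derivative with a polynomial in `z⁻¹` without constant term: the logarithm in the expansion
disappears. -/
lemma deriv_deriv_stirling_remainder {G ℓ : ℂ → ℂ}
    (hℓ : ∀ z : ℂ, 0 < z.re → AnalyticAt ℂ ℓ z ∧ exp (ℓ z) = G z) (A₁ b₁ A₀ b₀ : ℂ) (a : ℕ → ℂ)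
    (N : ℕ) {z : ℂ} (hz : 0 < z.re) :
    deriv (deriv fun z : ℂ => -ℓ z - (A₁ * (z * (log z - 1)) + b₁ * z + A₀ * log z + b₀
      + ∑ n ∈ Finset.Icc 1 N, a n * z ^ (-(n : ℤ)))) z =
    -deriv (logDeriv G) z - z⁻¹ * (Polynomial.C A₁ - Polynomial.C A₀ * Polynomial.X +
      ∑ n ∈ Finset.Icc 1 N, Polynomial.C (a n * (n * (n + 1))) *
        Polynomial.X ^ (n + 1)).eval z⁻¹ := by
  have hopen : IsOpen {w : ℂ | 0 < w.re} := isOpen_re_gt 0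
  have hev : ∀ {P : ℂ → Prop} {w : ℂ}, 0 < w.re → (∀ w : ℂ, 0 < w.re → P w) →
      ∀ᶠ w in nhds w, P w := fun hw h =>
    Filter.mem_of_superset (hopen.mem_nhds hw) h
  have hlog : ∀ w : ℂ, 0 < w.re → logDeriv G w = deriv ℓ w := by
    intro w hw
    have h1 : G =ᶠ[nhds w] fun u => exp (ℓ u) := hev hw fun u hu => ((hℓ u hu).2).symm
    rw [(logDeriv_congr_nhds h1).eq_of_nhds, logDeriv_apply, ((hℓ w hw).1.differentiableAt.hasDerivAt.cexp).deriv,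
      mul_div_cancel_left₀ _ (exp_ne_zero _)]
  have hslit : ∀ w : ℂ, 0 < w.re → w ∈ slitPlane := fun w hw => Or.inl hw
  have hne : ∀ w : ℂ, 0 < w.re → w ≠ 0 := fun w hw => slitPlane_ne_zero (hslit w hw)
  have hd1 : ∀ w : ℂ, 0 < w.re → HasDerivAt (fun z : ℂ => -ℓ z - (A₁ * (z * (log z - 1)) + b₁ * z
      + A₀ * log z + b₀ + ∑ n ∈ Finset.Icc 1 N, a n * z ^ (-(n : ℤ))))
      (-deriv ℓ w - (A₁ * log w + b₁ + A₀ * w⁻¹ +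
        ∑ n ∈ Finset.Icc 1 N, a n * ((-(n : ℤ) : ℤ) * w ^ (-(n : ℤ) - 1)))) w := by
    intro w hw
    have hw0 := hne w hw
    have hl := hasDerivAt_log (hslit w hw)
    have hs : HasDerivAt (fun z : ℂ => ∑ n ∈ Finset.Icc 1 N, a n * z ^ (-(n : ℤ)))
        (∑ n ∈ Finset.Icc 1 N, a n * ((-(n : ℤ) : ℤ) * w ^ (-(n : ℤ) - 1))) w :=
      HasDerivAt.fun_sum fun n _ => (hasDerivAt_zpow (-(n : ℤ)) w (Or.inl hw0)).const_mul _
    have h1 := ((hasDerivAt_id' w).fun_mul (hl.sub_const 1)).const_mul A₁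
    have h2 := (hasDerivAt_id' w).const_mul b₁
    have h := (hℓ w hw).1.differentiableAt.hasDerivAt.fun_neg.fun_sub
      ((((h1.fun_add h2).fun_add (hl.const_mul A₀)).add_const b₀).fun_add hs)
    refine h.congr_deriv ?_
    field_simp
    ring
  have hd2 : HasDerivAt (fun w : ℂ => -deriv ℓ w - (A₁ * log w + b₁ + A₀ * w⁻¹ +
        ∑ n ∈ Finset.Icc 1 N, a n * ((-(n : ℤ) : ℤ) * w ^ (-(n : ℤ) - 1))))
      (-deriv (deriv ℓ) z - (A₁ * z⁻¹ + A₀ * (-(z ^ 2)⁻¹) +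
        ∑ n ∈ Finset.Icc 1 N, a n * ((-(n : ℤ) : ℤ) * ((-(n : ℤ) - 1 : ℤ) *
          z ^ (-(n : ℤ) - 1 - 1))))) z := by
    have hz0 := hne z hz
    have hs : HasDerivAt (fun w : ℂ => ∑ n ∈ Finset.Icc 1 N,
          a n * ((-(n : ℤ) : ℤ) * w ^ (-(n : ℤ) - 1)))
        (∑ n ∈ Finset.Icc 1 N, a n * ((-(n : ℤ) : ℤ) * ((-(n : ℤ) - 1 : ℤ) *
          z ^ (-(n : ℤ) - 1 - 1)))) z :=
      HasDerivAt.fun_sum fun n _ =>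
        ((hasDerivAt_zpow (-(n : ℤ) - 1) z (Or.inl hz0)).const_mul _).const_mul _
    exact (hℓ z hz).1.deriv.differentiableAt.hasDerivAt.fun_neg.fun_sub
      (((((hasDerivAt_log (hslit z hz)).const_mul A₁).add_const b₁).fun_add
        ((hasDerivAt_inv hz0).const_mul A₀)).fun_add hs)
  rw [Filter.EventuallyEq.deriv_eq (hev hz fun w hw => (hd1 w hw).deriv), hd2.deriv,
    Filter.EventuallyEq.deriv_eq (hev hz hlog)]
  simp only [Polynomial.eval_add, Polynomial.eval_sub, Polynomial.eval_mul, Polynomial.eval_C,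
    Polynomial.eval_X, Polynomial.eval_finsetSum, Polynomial.eval_pow]
  have hz0 := hne z hz
  congr 1
  rw [mul_add, Finset.mul_sum]
  congr 1
  · field_simp
    ring
  · refine Finset.sum_congr rfl fun n _ => ?_
    rw [show (-(n : ℤ) - 1 - 1) = -((n + 2 : ℕ) : ℤ) by push_cast; ring, zpow_neg, zpow_natCast]
    push_cast
    rw [inv_pow]
    field_simp
    ring

namespace IsPrimaryFunction

variable {L G Ξ : ℂ → ℂ} {q : ℕ}

lemma G_ne_zero (hL : IsPrimaryFunction L G Ξ q) {z : ℂ} (hz : 0 < z.re) : G z ≠ 0 := fun h => by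
  linarith [hL.trivial_zeros z h]

lemma Xi_ne_zero (hL : IsPrimaryFunction L G Ξ q) {z : ℂ} (hz : 1 ≤ z.re) : Ξ z ≠ 0 := fun h => by
  linarith [(hL.nontrivial_zeros z h).2.1]

lemma G_re_le (hL : IsPrimaryFunction L G Ξ q) (ρ : ℂ) (h : G ρ = 0) : ρ.re ≤ 1 := by
  linarith [hL.trivial_zeros ρ h]

lemma Xi_re_le (hL : IsPrimaryFunction L G Ξ q) (ρ : ℂ) (h : Ξ ρ = 0) : ρ.re ≤ 1 :=
  (hL.nontrivial_zeros ρ h).2.1.le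

lemma L_ne_zero (hL : IsPrimaryFunction L G Ξ q) {z : ℂ} (h1 : z ≠ 1) (hG : G z ≠ 0)
    (hΞ : Ξ z ≠ 0) : L z ≠ 0 := by
  intro h
  have := hL.factorization z h1
  rw [h, mul_zero] at this
  exact mul_ne_zero hG hΞ this

lemma logDeriv_L (hL : IsPrimaryFunction L G Ξ q) {z : ℂ} (h1 : z ≠ 1) (hG : G z ≠ 0)
    (hΞ : Ξ z ≠ 0) : logDeriv L z = logDeriv G z + logDeriv Ξ z - q / (z - 1) := by
  have h1' : z - 1 ≠ 0 := sub_ne_zero.2 h1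
  have hev : (fun w => G w * Ξ w) =ᶠ[nhds z] fun w => (w - 1) ^ q * L w := by
    filter_upwards [isOpen_ne.mem_nhds h1] with w hw
    exact hL.factorization w hw
  have h := (logDeriv_congr_nhds hev).eq_of_nhds
  rw [logDeriv_mul z hG hΞ (hL.G_order.1 z) (hL.Xi_order.1 z),
    logDeriv_mul (f := fun w : ℂ => (w - 1) ^ q) (g := L) z (pow_ne_zero q h1') (hL.L_ne_zero h1 hG hΞ) (by fun_prop)
      (hL.analytic_off z h1).differentiableAt, logDeriv_fun_pow (by fun_prop)] at h
  have h2 : logDeriv (fun w : ℂ => w - 1) z = 1 / (z - 1) := by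
    rw [logDeriv_apply, ((hasDerivAt_id' z).sub_const (1 : ℂ)).deriv]
  rw [h, h2]
  ring

lemma eventually_ne_zero (hL : IsPrimaryFunction L G Ξ q) {z : ℂ} (h1 : z ≠ 1) (hG : G z ≠ 0)
    (hΞ : Ξ z ≠ 0) : ∀ᶠ w in nhds z, w ≠ 1 ∧ G w ≠ 0 ∧ Ξ w ≠ 0 :=
  (isOpen_ne.eventually_mem h1).and
    ((hL.G_order.1.continuous.continuousAt.eventually_ne hG).and
      (hL.Xi_order.1.continuous.continuousAt.eventually_ne hΞ))

lemma analyticAt_logDeriv_L (hL : IsPrimaryFunction L G Ξ q) {z : ℂ} (h1 : z ≠ 1) (hG : G z ≠ 0)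
    (hΞ : Ξ z ≠ 0) : AnalyticAt ℂ (logDeriv L) z :=
  (hL.analytic_off z h1).deriv.div (hL.analytic_off z h1) (hL.L_ne_zero h1 hG hΞ)

lemma deriv_logDeriv_L (hL : IsPrimaryFunction L G Ξ q) {z : ℂ} (h1 : z ≠ 1) (hG : G z ≠ 0)
    (hΞ : Ξ z ≠ 0) : deriv (logDeriv L) z =
      deriv (logDeriv G) z + deriv (logDeriv Ξ) z + q * ((z - 1) ^ 2)⁻¹ := by
  have h1' : z - 1 ≠ 0 := sub_ne_zero.2 h1
  have hev : logDeriv L =ᶠ[nhds z] fun w => logDeriv G w + logDeriv Ξ w - q / (w - 1) := by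
    filter_upwards [hL.eventually_ne_zero h1 hG hΞ] with w hw
    exact hL.logDeriv_L hw.1 hw.2.1 hw.2.2
  have hd : HasDerivAt (fun w : ℂ => (q : ℂ) / (w - 1)) (-(q * ((z - 1) ^ 2)⁻¹)) z := by
    refine ((hasDerivAt_const z (q : ℂ)).fun_div ((hasDerivAt_id' z).sub_const 1) h1').congr_deriv ?_
    field_simp
    ring
  rw [hev.deriv_eq, (((hL.G_order.1.analyticAt_logDeriv hG).differentiableAt.hasDerivAt.fun_add
    (hL.Xi_order.1.analyticAt_logDeriv hΞ).differentiableAt.hasDerivAt).fun_sub hd).deriv]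
  ring

lemma ne_zero_of_one_lt_re (hL : IsPrimaryFunction L G Ξ q) {z : ℂ} (hz : 1 < z.re) :
    z ≠ 1 ∧ G z ≠ 0 ∧ Ξ z ≠ 0 :=
  ⟨fun h => by rw [h] at hz; simp at hz, hL.G_ne_zero (by linarith), hL.Xi_ne_zero hz.le⟩

/-- Since `log L` tends to `0`, the values of `L` tend to `1` and stay off the branch cut of the
principal logarithm. -/
lemma eventually_L_mem_slitPlane (hL : IsPrimaryFunction L G Ξ q) :
    ∀ᶠ t : ℝ in atTop, L t ∈ slitPlane := by
  have h0 : Tendsto (fun t : ℝ => log (L t)) atTop (nhds 0) := by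
    have h := hL.log_decay 0 1
    simp only [iteratedDeriv_zero] at h
    refine h.trans_tendsto ?_
    simpa using tendsto_inv_atTop_zero
  have h1 : Tendsto (fun t : ℝ => exp (log (L t))) atTop (nhds 1) := by
    simpa [Function.comp_def] using (continuous_exp.tendsto 0).comp h0
  filter_upwards [h1.eventually (isOpen_slitPlane.eventually_mem one_mem_slitPlane),
    eventually_gt_atTop 1] with t ht ht1
  rwa [exp_log (hL.nonvanishing t (by simpa using ht1))] at ht

/-- The decay hypothesis on `log L`, restated for `L' / L`. -/
lemma iteratedDeriv_logDeriv_L_isBigO (hL : IsPrimaryFunction L G Ξ q) (j M : ℕ) :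
    (fun t : ℝ => iteratedDeriv j (logDeriv L) (t : ℂ)) =O[atTop] fun t : ℝ => t⁻¹ ^ M := by
  have h := isBigO_inv_pow_of_zpow (le_refl (M : ℤ)) (hL.log_decay (j + 1) M)
  refine h.congr' ?_ EventuallyEq.rfl
  filter_upwards [hL.eventually_L_mem_slitPlane, eventually_gt_atTop 1] with t ht ht1
  rw [iteratedDeriv_succ']
  refine Filter.EventuallyEq.iteratedDeriv_eq j ?_
  have hne : (t : ℂ) ≠ 1 := by exact_mod_cast ht1.ne'
  filter_upwards [(hL.analytic_off t hne).continuousAt.eventually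
    (isOpen_slitPlane.eventually_mem ht), isOpen_ne.eventually_mem hne] with w hw hw1
  exact (((hL.analytic_off w hw1).differentiableAt.hasDerivAt).clog hw).deriv

lemma exists_norm_deriv_logDeriv_L_le (hL : IsPrimaryFunction L G Ξ q) :
    ∃ C, 0 ≤ C ∧ ∀ t : ℝ, 4 ≤ t → ∀ z ∈ Metric.ball (t : ℂ) (t / 4),
      ‖deriv (logDeriv L) z‖ ≤ C := by
  obtain ⟨C₁, h₁⟩ := hL.G_order.exists_norm_deriv_logDeriv_le hL.G_re_le
  obtain ⟨C₂, h₂⟩ := hL.Xi_order.exists_norm_deriv_logDeriv_le hL.Xi_re_le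
  have hb : ∀ t : ℝ, 4 ≤ t → ∀ z ∈ Metric.ball (t : ℂ) (t / 4),
      ‖deriv (logDeriv L) z‖ ≤ C₁ + C₂ + q := by
    intro t ht z hz
    have hre := three_quarters_lt_re_of_mem_ball hz
    obtain ⟨h1, hG, hΞ⟩ := hL.ne_zero_of_one_lt_re (show 1 < z.re by linarith)
    have hz1 : 1 ≤ ‖z - 1‖ := by
      have := re_le_norm (z - 1)
      simp at this
      linarith
    rw [hL.deriv_logDeriv_L h1 hG hΞ]
    refine (norm_add₃_le).trans (add_le_add (add_le_add (h₁ t (by linarith) z hz)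
      (h₂ t (by linarith) z hz)) ?_)
    rw [norm_mul, norm_natCast, norm_inv, norm_pow]
    exact mul_le_of_le_one_right (Nat.cast_nonneg q)
      (inv_le_one_of_one_le₀ (one_le_pow₀ hz1))
  exact ⟨C₁ + C₂ + q, (norm_nonneg _).trans
    (hb 4 le_rfl ((4 : ℝ) : ℂ) (Metric.mem_ball_self (by norm_num))), hb⟩

/-- On every horizontal ray the derivative of `L' / L` decays faster than any power. -/
lemma deriv_logDeriv_L_shift (hL : IsPrimaryFunction L G Ξ q) (x : ℂ) (M : ℕ) :
    (fun t : ℝ => deriv (logDeriv L) (x + t)) =O[atTop] fun t : ℝ => t⁻¹ ^ M := by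
  obtain ⟨C, -, hC⟩ := hL.exists_norm_deriv_logDeriv_L_le
  refine isBigO_shift (p := 0) (C := C) ?_ (fun j => ?_) x
  · filter_upwards [eventually_ge_atTop 4] with t ht z hz
    have hre := three_quarters_lt_re_of_mem_ball hz
    obtain ⟨h1, hG, hΞ⟩ := hL.ne_zero_of_one_lt_re (show 1 < z.re by linarith)
    exact ⟨(hL.analyticAt_logDeriv_L h1 hG hΞ).deriv.differentiableAt, by simpa using hC t ht z hz⟩
  · simpa only [iteratedDeriv_succ'] using hL.iteratedDeriv_logDeriv_L_isBigO (j + 1) M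

/-- On every horizontal ray `L' / L` decays faster than any power.  Its growth on discs, needed for
`isBigO_shift`, comes from integrating the bound on its derivative. -/
lemma logDeriv_L_shift (hL : IsPrimaryFunction L G Ξ q) (x : ℂ) (M : ℕ) :
    (fun t : ℝ => logDeriv L (x + t)) =O[atTop] fun t : ℝ => t⁻¹ ^ M := by
  obtain ⟨C, hC0, hC⟩ := hL.exists_norm_deriv_logDeriv_L_le
  obtain ⟨B, hB⟩ : ∃ B : ℝ, ∀ᶠ t : ℝ in atTop, ‖logDeriv L (t : ℂ)‖ ≤ B := by
    obtain ⟨B, hB⟩ := (hL.iteratedDeriv_logDeriv_L_isBigO 0 0).bound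
    exact ⟨B, by simpa using hB⟩
  refine isBigO_shift (p := 1) (C := |B| + C) ?_
    (fun j => hL.iteratedDeriv_logDeriv_L_isBigO j M) x
  filter_upwards [hB, eventually_ge_atTop 4] with t hBt ht
  have hdiff : ∀ z ∈ Metric.ball (t : ℂ) (t / 4), DifferentiableAt ℂ (logDeriv L) z := by
    intro z hz
    have hre := three_quarters_lt_re_of_mem_ball hz
    obtain ⟨h1, hG, hΞ⟩ := hL.ne_zero_of_one_lt_re (show 1 < z.re by linarith)
    exact (hL.analyticAt_logDeriv_L h1 hG hΞ).differentiableAt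
  intro z hz
  refine ⟨hdiff z hz, ?_⟩
  have hmv := (convex_ball (t : ℂ) (t / 4)).norm_image_sub_le_of_norm_deriv_le hdiff
    (fun z hz => hC t ht z hz) (Metric.mem_ball_self (by linarith)) hz
  have hz' : ‖z - t‖ < t / 4 := by simpa [dist_eq_norm] using hz
  have h2 : ‖logDeriv L z‖ ≤ ‖logDeriv L z - logDeriv L t‖ + ‖logDeriv L t‖ := by
    simpa using norm_add_le (logDeriv L z - logDeriv L t) (logDeriv L t)
  have h3 := le_abs_self B
  have h4 := abs_nonneg B
  rw [pow_one]
  calc ‖logDeriv L z‖ ≤ C * ‖z - t‖ + |B| := by linarith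
    _ ≤ C * t + |B| * t := by
      gcongr
      · linarith
      · nlinarith
    _ = _ := by ring

/-- The expansion of the second logarithmic derivative of `G` on every horizontal ray.  The Stirling
hypothesis gives it on the real axis together with all derivatives, which is what `isBigO_shift`
needs. -/
theorem hasInvPowExpansion_G (hL : IsPrimaryFunction L G Ξ q) (x : ℂ) :
    HasInvPowExpansion fun y : ℝ => -deriv (logDeriv G) (x + y) := by
  obtain ⟨ℓ, A₁, b₁, A₀, b₀, a, hℓ, hexp⟩ := hL.stirling
  refine HasInvPowExpansion.of_approx fun N => ?_
  set D : ℂ → ℂ := fun z : ℂ => -ℓ z - (A₁ * (z * (log z - 1)) + b₁ * z + A₀ * log z + b₀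
    + ∑ n ∈ Finset.Icc 1 N, a n * z ^ (-(n : ℤ))) with hDdef
  set Q : Polynomial ℂ := Polynomial.C A₁ - Polynomial.C A₀ * Polynomial.X +
      ∑ n ∈ Finset.Icc 1 N, Polynomial.C (a n * (n * (n + 1))) * Polynomial.X ^ (n + 1)
  have hDD : ∀ z : ℂ, 0 < z.re → deriv (deriv D) z = -deriv (logDeriv G) z - z⁻¹ * Q.eval z⁻¹ :=
    fun z hz => deriv_deriv_stirling_remainder hℓ A₁ b₁ A₀ b₀ a N hz
  refine ⟨fun y : ℝ => (x + y)⁻¹ * Q.eval (x + y)⁻¹, (HasInvPowExpansion.inv_add x).mul_eval Q, ?_⟩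
  obtain ⟨C, hC⟩ := hL.G_order.exists_norm_deriv_logDeriv_le hL.G_re_le
  obtain ⟨B, hB⟩ := (isCompact_closedBall (0 : ℂ) 1).exists_bound_of_continuousOn
    (f := fun w : ℂ => w * Q.eval w) (continuous_id.mul Q.continuous).continuousOn
  have hbig : (fun t : ℝ => deriv (deriv D) (x + t)) =O[atTop] fun t : ℝ => t⁻¹ ^ N := by
    refine isBigO_shift (p := 0) (C := C + B) ?_ (fun j => ?_) x
    · filter_upwards [eventually_ge_atTop 4] with t ht z hz
      have hre := three_quarters_lt_re_of_mem_ball hz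
      have hz0 : 0 < z.re := by linarith
      have hz1 : 1 ≤ ‖z‖ := by linarith [re_le_norm z]
      constructor
      · have hev : deriv (deriv D) =ᶠ[nhds z]
            fun z => -deriv (logDeriv G) z - z⁻¹ * Q.eval z⁻¹ :=
          Filter.mem_of_superset ((isOpen_re_gt 0).mem_nhds hz0) hDD
        refine DifferentiableAt.congr_of_eventuallyEq ?_ hev
        have hinv : DifferentiableAt ℂ (fun z : ℂ => z⁻¹) z :=
          differentiableAt_inv (norm_pos_iff.1 (by linarith))
        exact (hL.G_order.1.analyticAt_logDeriv
          (hL.G_ne_zero hz0)).deriv.differentiableAt.fun_neg.fun_sub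
            (hinv.fun_mul (Q.differentiable.differentiableAt.fun_comp' z hinv))
      · rw [hDD z hz0, pow_zero, mul_one]
        refine (norm_sub_le _ _).trans (add_le_add ?_ ?_)
        · rw [norm_neg]
          exact hC t (by linarith) z hz
        · refine hB z⁻¹ ?_
          rw [mem_closedBall_zero_iff, norm_inv]
          exact inv_le_one_of_one_le₀ hz1
    · have h := hexp N (j + 2)
      simp only [iteratedDeriv_succ'] at h
      exact isBigO_inv_pow_of_zpow (by push_cast; omega) h
  refine hbig.congr' ?_ EventuallyEq.rfl
  filter_upwards [eventually_gt_atTop (-x.re)] with y hy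
  exact hDD _ (by simp; linarith)

lemma eventually_ray_ne_zero (hL : IsPrimaryFunction L G Ξ q) (x : ℂ) :
    ∀ᶠ y : ℝ in atTop, x + y ≠ 1 ∧ G (x + y) ≠ 0 ∧ Ξ (x + y) ≠ 0 := by
  filter_upwards [eventually_gt_atTop (1 - x.re)] with y hy
  exact hL.ne_zero_of_one_lt_re (by simp; linarith)

/-- The functional equation between `Ξ`, `G` and `L` carries the expansion over from `G` to `Ξ`. -/
theorem hasInvPowExpansion_Xi (hL : IsPrimaryFunction L G Ξ q) (x : ℂ) :
    HasInvPowExpansion fun y : ℝ => -deriv (logDeriv Ξ) (x + y) := by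
  have h1 := HasInvPowExpansion.of_isBigO (hL.deriv_logDeriv_L_shift x)
  have h2 := HasInvPowExpansion.inv_add (x - 1)
  refine (((hL.hasInvPowExpansion_G x).const_mul (-1)).add
    (((h2.mul h2).const_mul q).add (h1.const_mul (-1)))).congr ?_
  filter_upwards [hL.eventually_ray_ne_zero x] with y ⟨hy1, hG, hΞ⟩
  rw [hL.deriv_logDeriv_L hy1 hG hΞ, show x - 1 + (y : ℂ) = x + y - 1 by ring]
  rw [← mul_inv, ← pow_two]
  ring

lemma isEligible_G_of_pos (hL : IsPrimaryFunction L G Ξ q) {x : ℝ} (hx : 0 < x) :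
    IsEligible G (x : ℂ) := fun ρ hρ => by
  have := hL.trivial_zeros ρ hρ
  exact Or.inl (by simp; linarith)

lemma isEligible_Xi_ofReal (hL : IsPrimaryFunction L G Ξ q) (x : ℝ) :
    IsEligible Ξ (x : ℂ) := fun ρ hρ =>
  Or.inr (by simpa using (hL.nontrivial_zeros ρ hρ).2.2)

end IsPrimaryFunction

lemma continuousOn_neg_deriv_logDeriv {f : ℂ → ℂ} (hf : Differentiable ℂ f) {x : ℂ}
    (hx : IsEligible f x) :
    ContinuousOn (fun y : ℝ => -deriv (logDeriv f) (x + y)) (Ici 0) := fun y hy => by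
  have h := (hf.analyticAt_logDeriv (hx.apply_add_ne_zero hy)).deriv.continuousAt
  have h2 : ContinuousAt (fun y : ℝ => x + (y : ℂ)) y := by fun_prop
  exact (ContinuousAt.comp (g := deriv (logDeriv f)) (f := fun y : ℝ => x + (y : ℂ)) h h2).neg.continuousWithinAt

/-! ### The functional relations -/

lemma HasInvPowExpansion.isBigO_inv {g : ℝ → ℂ} (hg : HasInvPowExpansion g) :
    g =O[atTop] fun y : ℝ => y⁻¹ ^ 1 := by
  obtain ⟨P, hP⟩ := hg 1
  have h1 : (fun y : ℝ => P.eval (y : ℂ)⁻¹) =O[atTop] fun _ : ℝ => (1 : ℝ) :=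
    ((P.continuous.tendsto 0).comp tendsto_ofReal_inv_atTop).isBigO_one ℝ
  have h2 : (fun y : ℝ => (y : ℂ)⁻¹) =O[atTop] fun y : ℝ => y⁻¹ ^ 1 :=
    IsBigO.of_bound 1 (Eventually.of_forall fun y => by simp)
  have h3 := h2.mul h1
  simp only [mul_one] at h3
  exact (hP.add h3).congr_left fun y => by ring

lemma mellinConvergent_of_isBigO_inv_pow {g : ℝ → ℂ} (hg : ContinuousOn g (Ici 0)) {M : ℕ}
    (hM : g =O[atTop] fun y : ℝ => y⁻¹ ^ M) {u : ℂ} (h0 : 0 < u.re) (hu : u.re < M) :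
    MellinConvergent g u :=
  mellinConvergent_of_isBigO_rpow
    ((hg.mono Ioi_subset_Ici_self).locallyIntegrableOn measurableSet_Ioi)
    (hM.trans (inv_pow_isBigO_rpow M)) hu (isBigO_one_nhdsGT_zero hg) h0

lemma differentiableAt_mellin_of_isBigO_inv_pow {g : ℝ → ℂ} (hg : ContinuousOn g (Ici 0)) {M : ℕ}
    (hM : g =O[atTop] fun y : ℝ => y⁻¹ ^ M) {u : ℂ} (h0 : 0 < u.re) (hu : u.re < M) :
    DifferentiableAt ℂ (mellin g) u :=
  mellin_differentiableAt_of_isBigO_rpow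
    ((hg.mono Ioi_subset_Ici_self).locallyIntegrableOn measurableSet_Ioi)
    (hM.trans (inv_pow_isBigO_rpow M)) hu (isBigO_one_nhdsGT_zero hg) h0

/-- Integration by parts: the Mellin transform of a derivative. -/
theorem mellin_deriv_eq {ψ ψ' : ℝ → ℂ} (hψ : ContinuousOn ψ (Ici 0))
    (hψ' : ContinuousOn ψ' (Ici 0)) (hd : ∀ y : ℝ, 0 < y → HasDerivAt ψ (ψ' y) y) {a b : ℕ}
    (ha : ψ =O[atTop] fun y : ℝ => y⁻¹ ^ a) (hb : ψ' =O[atTop] fun y : ℝ => y⁻¹ ^ b) {s : ℂ}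
    (h1 : s.re < 1) (hsa : 1 - s.re < a) (hsb : 2 - s.re < b) :
    mellin ψ' (2 - s) = -(1 - s) * mellin ψ (1 - s) := by
  have hs1 : -s ≠ -1 := fun h => by
    rw [neg_injective h] at h1
    simp at h1
  have hs0 : -s + 1 ≠ 0 := fun h => hs1 (eq_neg_of_add_eq_zero_left h)
  have hre : (-s + 1).re = 1 - s.re := by simp; ring
  have hI1 : MellinConvergent ψ (1 - s) :=
    mellinConvergent_of_isBigO_inv_pow hψ ha (by simpa using h1) (by simpa using hsa)
  have hI2 : MellinConvergent ψ' (2 - s) :=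
    mellinConvergent_of_isBigO_inv_pow hψ' hb (by simp; linarith) (by simpa using hsb)
  have hnorm : ∀ y : ℝ, 0 < y → ‖(y : ℂ) ^ (-s + 1) / (-s + 1)‖ =
      y ^ (1 - s.re) * ‖-s + 1‖⁻¹ := by
    intro y hy
    rw [norm_div, norm_cpow_eq_rpow_re_of_pos hy, hre, div_eq_mul_inv]
  have hzero : Tendsto ((fun y : ℝ => (y : ℂ) ^ (-s + 1) / (-s + 1)) * ψ)
      (nhdsWithin 0 (Ioi 0)) (nhds 0) := by
    have hu : Tendsto (fun y : ℝ => (y : ℂ) ^ (-s + 1) / (-s + 1)) (nhdsWithin 0 (Ioi 0))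
        (nhds 0) := by
      rw [tendsto_zero_iff_norm_tendsto_zero]
      have h := ((Real.continuousAt_rpow_const 0 (1 - s.re) (Or.inr (by linarith))).tendsto.mono_left
        (nhdsWithin_le_nhds (s := Ioi 0))).mul_const ‖-s + 1‖⁻¹
      rw [Real.zero_rpow (by linarith), zero_mul] at h
      refine h.congr' ?_
      filter_upwards [self_mem_nhdsWithin] with y (hy : 0 < y)
      exact (hnorm y hy).symm
    have hψ0 := ((hψ 0 self_mem_Ici).mono Ioi_subset_Ici_self).tendsto
    simpa [Pi.mul_def] using hu.mul hψ0
  have hinfty : Tendsto ((fun y : ℝ => (y : ℂ) ^ (-s + 1) / (-s + 1)) * ψ) atTop (nhds 0) := by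
    have hu : (fun y : ℝ => (y : ℂ) ^ (-s + 1) / (-s + 1)) =O[atTop]
        fun y : ℝ => y ^ (1 - s.re) := by
      refine IsBigO.of_bound ‖-s + 1‖⁻¹ ?_
      filter_upwards [eventually_gt_atTop 0] with y hy
      rw [hnorm y hy, Real.norm_of_nonneg (by positivity), mul_comm]
    refine (hu.mul (ha.trans (inv_pow_isBigO_rpow a))).trans_tendsto ?_
    refine (tendsto_rpow_neg_atTop (y := a - (1 - s.re)) (by linarith)).congr' ?_
    filter_upwards [eventually_gt_atTop 0] with y hy
    rw [← Real.rpow_add hy]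
    congr 1
    ring
  have e2 : ∀ y : ℝ, (y : ℂ) ^ (-s + 1) / (-s + 1) * ψ' y =
      (-s + 1)⁻¹ * ((y : ℂ) ^ (2 - s - 1) • ψ' y) := by
    intro y
    rw [show 2 - s - 1 = -s + 1 by ring, smul_eq_mul]
    ring
  have e1 : ∀ y : ℝ, (y : ℂ) ^ (-s) * ψ y = (y : ℂ) ^ (1 - s - 1) • ψ y := by
    intro y
    rw [show 1 - s - 1 = -s by ring, smul_eq_mul]
  have key := integral_Ioi_mul_deriv_eq_deriv_mul (a := 0) (a' := 0) (b' := 0)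
    (u := fun y : ℝ => (y : ℂ) ^ (-s + 1) / (-s + 1)) (u' := fun y : ℝ => (y : ℂ) ^ (-s))
    (v := ψ) (v' := ψ') (fun y hy => hasDerivAt_ofReal_cpow_const' (ne_of_gt hy) hs1)
    (fun y hy => hd y hy) ?_ ?_ hzero hinfty
  · simp_rw [e1, e2] at key
    rw [integral_const_mul, sub_zero, zero_sub] at key
    have key' : (-s + 1)⁻¹ * mellin ψ' (2 - s) = -mellin ψ (1 - s) := key
    rw [inv_mul_eq_iff_eq_mul₀ hs0] at key'
    rw [key']
    ring
  · refine IntegrableOn.congr_fun (f := fun y : ℝ => (-s + 1)⁻¹ * ((y : ℂ) ^ (2 - s - 1) • ψ' y))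
      (hI2.const_mul _) (fun y _ => ?_) measurableSet_Ioi
    exact (e2 y).symm
  · refine IntegrableOn.congr_fun (f := fun y : ℝ => (y : ℂ) ^ (1 - s - 1) • ψ y)
      hI1 (fun y _ => ?_) measurableSet_Ioi
    exact (e1 y).symm

lemma differentiableAt_sin_div_pi_mul_mellin {g : ℝ → ℂ} (hg : ContinuousOn g (Ici 0)) {M : ℕ}
    (hM : g =O[atTop] fun y : ℝ => y⁻¹ ^ M) {s : ℂ} (h2 : s.re < 2) (hs : 2 - s.re < M) :
    DifferentiableAt ℂ (fun s => sin ((Real.pi : ℂ) * s) / (Real.pi : ℂ) * mellin g (2 - s)) s := by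
  have hm : DifferentiableAt ℂ (mellin g) (2 - s) :=
    differentiableAt_mellin_of_isBigO_inv_pow hg hM (by simpa using h2) (by simpa using hs)
  have hm' : DifferentiableAt ℂ (fun s => mellin g (2 - s)) s :=
    DifferentiableAt.comp (g := mellin g) s hm (by fun_prop)
  have hsin : DifferentiableAt ℂ (fun s => sin ((Real.pi : ℂ) * s) / (Real.pi : ℂ)) s := by
    fun_prop
  exact hsin.fun_mul hm'

lemma hasDerivAt_ray {f : ℂ → ℂ} {x f' : ℂ} {y : ℝ} (h : HasDerivAt f f' (x + y)) :
    HasDerivAt (fun y : ℝ => f (x + y)) f' y :=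
  (h.comp_const_add x (y : ℂ)).comp_ofReal

lemma continuousOn_ray {f : ℂ → ℂ} {x : ℂ} (h : ∀ y : ℝ, 0 ≤ y → ContinuousAt f (x + y)) :
    ContinuousOn (fun y : ℝ => f (x + y)) (Ici 0) := fun y hy =>
  (ContinuousAt.comp (f := fun y : ℝ => x + (y : ℂ)) (h y hy)
    (by fun_prop)).continuousWithinAt

namespace IsPrimaryFunction

variable {L G Ξ : ℂ → ℂ} {q : ℕ}

/-- In the strip `1 < Re s < 2` the two zeta functions add up to one Mellin transform, whose
integrand is minus the derivative of `L' / L + q / (z - 1)`. -/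
lemma add_eq_mellin (hL : IsPrimaryFunction L G Ξ q) {x : ℂ} (hΞ : IsEligible Ξ x)
    (hG : IsEligible G x) {J K : ℂ → ℂ} (hJ : IsEntireZeta Ξ x J) (hK : IsEntireZeta G x K) {s : ℂ}
    (h1 : 1 < s.re) (h2 : s.re < 2) :
    J s + K s = sin ((Real.pi : ℂ) * s) / (Real.pi : ℂ) *
      mellin (fun y : ℝ => -deriv (logDeriv Ξ) (x + y) + -deriv (logDeriv G) (x + y)) (2 - s) := by
  have hre0 : 0 < (2 - s).re := by simpa using h2
  have hre1 : (2 - s).re < (1 : ℕ) := by simp; linarith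
  have c1 := mellinConvergent_of_isBigO_inv_pow
    (continuousOn_neg_deriv_logDeriv hL.Xi_order.1 hΞ) (hL.hasInvPowExpansion_Xi x).isBigO_inv
    hre0 hre1
  have c2 := mellinConvergent_of_isBigO_inv_pow
    (continuousOn_neg_deriv_logDeriv hL.G_order.1 hG) (hL.hasInvPowExpansion_G x).isBigO_inv
    hre0 hre1
  rw [hJ.2 s h1, hK.2 s h1, hL.Xi_order.one_sub_mul_tsum_eq hL.Xi_re_le hΞ h1 h2,
    hL.G_order.one_sub_mul_tsum_eq hL.G_re_le hG h1 h2, (hasMellin_add c1 c2).2, mul_add]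

/-- The functional relation off the cut, in the form of an integral of `L' / L`. -/
theorem zeta_relation (hL : IsPrimaryFunction L G Ξ q) {x : ℂ} (hx : x - 1 ∈ slitPlane)
    (hΞ : IsEligible Ξ x) (hG : IsEligible G x) {J K : ℂ → ℂ} (hJ : IsEntireZeta Ξ x J)
    (hK : IsEntireZeta G x K) {s : ℂ} (hs : s.re < 1) :
    IntegrableOn (fun y : ℝ => logDeriv L (x + (y : ℂ)) * (y : ℂ) ^ (-s)) (Ioi 0) ∧
      J s / (1 - s) = -(K s / (1 - s)) + (q : ℂ) * (x - 1) ^ (-s)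
        + sin ((Real.pi : ℂ) * s) / (Real.pi : ℂ)
          * ∫ y in Ioi (0 : ℝ), logDeriv L (x + (y : ℂ)) * (y : ℂ) ^ (-s) := by
  have hray : ∀ y : ℝ, 0 ≤ y → x + y ≠ 1 ∧ G (x + y) ≠ 0 ∧ Ξ (x + y) ≠ 0 := by
    intro y hy
    refine ⟨fun h => ?_, hG.apply_add_ne_zero hy, hΞ.apply_add_ne_zero hy⟩
    refine add_ofReal_ne_zero_of_slitPlane hx hy ?_
    rw [sub_add_eq_add_sub, h, sub_self]
  have han : ∀ y : ℝ, 0 ≤ y → AnalyticAt ℂ (logDeriv L) (x + y) := fun y hy =>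
    hL.analyticAt_logDeriv_L (hray y hy).1 (hray y hy).2.1 (hray y hy).2.2
  set ψ : ℝ → ℂ := fun y => logDeriv L (x + y)
  set ψ' : ℝ → ℂ := fun y => deriv (logDeriv L) (x + y)
  have hψ : ContinuousOn ψ (Ici 0) := continuousOn_ray fun y hy => (han y hy).continuousAt
  have hψ' : ContinuousOn ψ' (Ici 0) := continuousOn_ray fun y hy => (han y hy).deriv.continuousAt
  have hd : ∀ y : ℝ, 0 < y → HasDerivAt ψ (ψ' y) y := fun y hy =>
    hasDerivAt_ray (han y hy.le).differentiableAt.hasDerivAt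
  have hstrip : ∀ s : ℂ, 1 < s.re → s.re < 2 → J s + K s =
      (q : ℂ) * ((1 - s) * (x - 1) ^ (-s)) -
        sin ((Real.pi : ℂ) * s) / (Real.pi : ℂ) * mellin ψ' (2 - s) := by
    intro s h1 h2
    have hu0 : 0 < (2 - s).re := by simpa using h2
    have hu1 : (2 - s).re < 1 := by simp; linarith
    have c1 : MellinConvergent (fun y : ℝ => (q : ℂ) • ((x - 1 + (y : ℂ)) ^ 2)⁻¹) (2 - s) :=
      (mellinConvergent_inv_add_sq hx hu0 (by linarith)).const_smul _
    have c2 : MellinConvergent ψ' (2 - s) :=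
      mellinConvergent_of_isBigO_inv_pow hψ' (hL.deriv_logDeriv_L_shift x 1) hu0 (by simpa using hu1)
    have hcongr : mellin (fun y : ℝ =>
        -deriv (logDeriv Ξ) (x + y) + -deriv (logDeriv G) (x + y)) (2 - s) =
        mellin (fun y : ℝ => (q : ℂ) • ((x - 1 + (y : ℂ)) ^ 2)⁻¹ - ψ' y) (2 - s) := by
      refine setIntegral_congr_fun measurableSet_Ioi fun y (hy : 0 < y) => ?_
      have hr := hray y hy.le
      simp only [ψ']
      rw [hL.deriv_logDeriv_L hr.1 hr.2.1 hr.2.2, sub_add_eq_add_sub]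
      simp only [smul_eq_mul]
      ring
    rw [hL.add_eq_mellin hΞ hG hJ hK h1 h2, hcongr, (hasMellin_sub c1 c2).2, mellin_const_smul,
      mellin_inv_add_sq hx hu0 (by linarith),
      ← sin_div_pi_mul_Gamma_mul_Gamma (s := s) (by linarith) h2 (fun h => by simp [h] at h1),
      smul_eq_mul, show 2 - s - 2 = -s by ring, show 2 - (2 - s) = s by ring]
    ring
  have hext := eqOn_of_eqOn_substrip (U := {s : ℂ | s.re < 2})
    (isOpen_lt continuous_re continuous_const) (convex_halfSpace_re_lt 2).isPreconnected
    (A := fun s => J s + K s) (B := fun s => (q : ℂ) * ((1 - s) * (x - 1) ^ (-s)) -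
        sin ((Real.pi : ℂ) * s) / (Real.pi : ℂ) * mellin ψ' (2 - s)) (a := 1) (b := 2)
    (hJ.1.add hK.1).differentiableOn (fun w (hw : w.re < 2) => by
      obtain ⟨M, hM⟩ := exists_nat_gt (2 - w.re)
      have h1 : DifferentiableAt ℂ (fun s : ℂ => (x - 1) ^ (-s)) w :=
        differentiableAt_id.neg.const_cpow (Or.inl (slitPlane_ne_zero hx))
      have h2 : DifferentiableAt ℂ (fun s : ℂ => 1 - s) w := by fun_prop
      exact (((h2.fun_mul h1).const_mul (q : ℂ)).fun_sub
        (differentiableAt_sin_div_pi_mul_mellin hψ' (hL.deriv_logDeriv_L_shift x M) hw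
          hM)).differentiableWithinAt)
    (by norm_num) (fun s _ h => h) hstrip
  have hs1 : 1 - s ≠ 0 := sub_ne_zero.2 fun h => by rw [← h] at hs; simp at hs
  obtain ⟨M, hM⟩ := exists_nat_gt (2 - s.re)
  have hparts := mellin_deriv_eq hψ hψ' hd (hL.logDeriv_L_shift x M)
    (hL.deriv_logDeriv_L_shift x M) hs (by linarith) hM
  have hconv : MellinConvergent ψ (1 - s) :=
    mellinConvergent_of_isBigO_inv_pow hψ (hL.logDeriv_L_shift x M) (by simpa using hs)
      (by simp; linarith)
  have hfun : ∀ y : ℝ, (y : ℂ) ^ (1 - s - 1) • ψ y = logDeriv L (x + y) * (y : ℂ) ^ (-s) := by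
    intro y
    rw [show 1 - s - 1 = -s by ring, smul_eq_mul, mul_comm]
  have hmel : mellin ψ (1 - s) =
      ∫ y in Ioi (0 : ℝ), logDeriv L (x + (y : ℂ)) * (y : ℂ) ^ (-s) := by
    simp only [mellin, hfun]
  refine ⟨?_, ?_⟩
  · simpa only [MellinConvergent, hfun] using hconv
  · have hfin := hext (show s.re < 2 by linarith)
    simp only at hfin
    rw [hparts] at hfin
    rw [← hmel]
    generalize sin ((Real.pi : ℂ) * s) / (Real.pi : ℂ) = c at hfin ⊢
    field_simp
    linear_combination hfin

/-- The functional relation on the positive real axis, where the pole of `L` on the ray of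
integration is removed from the integrand. -/
theorem zeta_relation_of_pos (hL : IsPrimaryFunction L G Ξ q) {x : ℝ} (hx : 0 < x)
    {J K : ℂ → ℂ} (hJ : IsEntireZeta Ξ (x : ℂ) J) (hK : IsEntireZeta G (x : ℂ) K) {s : ℂ}
    (hs0 : 0 < s.re) (hs : s.re < 1) :
    IntegrableOn (fun y : ℝ => (logDeriv L ((x : ℂ) + (y : ℂ)) +
        (q : ℂ) / ((x : ℂ) + (y : ℂ) - 1)) * (y : ℂ) ^ (-s)) (Ioi 0) ∧
      J s / (1 - s) = -(K s / (1 - s)) + sin ((Real.pi : ℂ) * s) / (Real.pi : ℂ)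
          * ∫ y in Ioi (0 : ℝ), (logDeriv L ((x : ℂ) + (y : ℂ)) +
            (q : ℂ) / ((x : ℂ) + (y : ℂ) - 1)) * (y : ℂ) ^ (-s) := by
  have hΞ := hL.isEligible_Xi_ofReal x
  have hG := hL.isEligible_G_of_pos hx
  have hanΞ : ∀ y : ℝ, 0 ≤ y → AnalyticAt ℂ (logDeriv Ξ) (x + y) := fun y hy =>
    hL.Xi_order.1.analyticAt_logDeriv (hΞ.apply_add_ne_zero hy)
  have hanG : ∀ y : ℝ, 0 ≤ y → AnalyticAt ℂ (logDeriv G) (x + y) := fun y hy =>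
    hL.G_order.1.analyticAt_logDeriv (hG.apply_add_ne_zero hy)
  set ψ : ℝ → ℂ := fun y => logDeriv Ξ (x + y) + logDeriv G (x + y)
  set ψ' : ℝ → ℂ := fun y => deriv (logDeriv Ξ) (x + y) + deriv (logDeriv G) (x + y)
  have hψ : ContinuousOn ψ (Ici 0) :=
    (continuousOn_ray fun y hy => (hanΞ y hy).continuousAt).add
      (continuousOn_ray fun y hy => (hanG y hy).continuousAt)
  have hψ' : ContinuousOn ψ' (Ici 0) :=
    (continuousOn_ray fun y hy => (hanΞ y hy).deriv.continuousAt).add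
      (continuousOn_ray fun y hy => (hanG y hy).deriv.continuousAt)
  have hd : ∀ y : ℝ, 0 < y → HasDerivAt ψ (ψ' y) y := fun y hy =>
    (hasDerivAt_ray (hanΞ y hy.le).differentiableAt.hasDerivAt).fun_add
      (hasDerivAt_ray (hanG y hy.le).differentiableAt.hasDerivAt)
  have hinv := (HasInvPowExpansion.inv_add ((x : ℂ) - 1)).isBigO_inv
  have hψO : ψ =O[atTop] fun y : ℝ => y⁻¹ ^ 1 := by
    refine ((hL.logDeriv_L_shift x 1).add (hinv.const_mul_left (q : ℂ))).congr' ?_ EventuallyEq.rfl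
    filter_upwards [hL.eventually_ray_ne_zero x] with y ⟨hy1, hyG, hyΞ⟩
    simp only [ψ]
    rw [hL.logDeriv_L hy1 hyG hyΞ, sub_add_eq_add_sub]
    ring
  have hψO' : ψ' =O[atTop] fun y : ℝ => y⁻¹ ^ 2 := by
    have h2 : (fun y : ℝ => ((x : ℂ) - 1 + y)⁻¹ * ((x : ℂ) - 1 + y)⁻¹) =O[atTop]
        fun y : ℝ => y⁻¹ ^ 2 := by
      simpa only [← pow_add] using hinv.mul hinv
    refine ((hL.deriv_logDeriv_L_shift x 2).sub (h2.const_mul_left (q : ℂ))).congr' ?_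
      EventuallyEq.rfl
    filter_upwards [hL.eventually_ray_ne_zero x] with y ⟨hy1, hyG, hyΞ⟩
    simp only [ψ']
    rw [hL.deriv_logDeriv_L hy1 hyG hyΞ, sub_add_eq_add_sub, ← mul_inv, ← pow_two]
    ring
  have hstrip : ∀ s : ℂ, 1 < s.re → s.re < 2 → J s + K s =
      -(sin ((Real.pi : ℂ) * s) / (Real.pi : ℂ) * mellin ψ' (2 - s)) := by
    intro s h1 h2
    rw [hL.add_eq_mellin hΞ hG hJ hK h1 h2]
    have : (fun y : ℝ => -deriv (logDeriv Ξ) (x + y) + -deriv (logDeriv G) (x + y)) =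
        fun y => (-1 : ℂ) • ψ' y := by
      funext y
      simp only [ψ', smul_eq_mul]
      ring
    rw [this, mellin_const_smul, smul_eq_mul]
    ring
  have hext := eqOn_of_eqOn_substrip (U := {s : ℂ | 0 < s.re ∧ s.re < 2})
    ((isOpen_re_gt 0).inter (isOpen_lt continuous_re continuous_const))
    ((convex_halfSpace_re_gt 0).inter (convex_halfSpace_re_lt 2)).isPreconnected
    (A := fun s => J s + K s)
    (B := fun s => -(sin ((Real.pi : ℂ) * s) / (Real.pi : ℂ) * mellin ψ' (2 - s)))
    (a := 1) (b := 2) (hJ.1.add hK.1).differentiableOn (fun w hw => by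
      exact (differentiableAt_sin_div_pi_mul_mellin hψ' hψO' hw.2
        (by push_cast; linarith [hw.1])).fun_neg.differentiableWithinAt)
    (by norm_num) (fun s h1 h2 => ⟨by linarith, h2⟩) hstrip
  have hs1 : 1 - s ≠ 0 := sub_ne_zero.2 fun h => by rw [← h] at hs; simp at hs
  have hparts := mellin_deriv_eq hψ hψ' hd hψO hψO' hs (by push_cast; linarith)
    (by push_cast; linarith)
  have hconv : MellinConvergent ψ (1 - s) :=
    mellinConvergent_of_isBigO_inv_pow hψ hψO (by simpa using hs) (by simp; linarith)
  -- the integrands differ at most at the single point `y = 1 - x`, the pole of `L`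
  have hae : (fun y : ℝ => (y : ℂ) ^ (1 - s - 1) • ψ y) =ᵐ[volume.restrict (Ioi 0)]
      fun y : ℝ => (logDeriv L ((x : ℂ) + (y : ℂ)) +
        (q : ℂ) / ((x : ℂ) + (y : ℂ) - 1)) * (y : ℂ) ^ (-s) := by
    have hne : ∀ᵐ y : ℝ ∂(volume.restrict (Ioi 0)), y ≠ 1 - x :=
      ae_restrict_of_ae (Measure.ae_ne volume (1 - x))
    filter_upwards [hne, ae_restrict_mem measurableSet_Ioi] with y hy (hy0 : 0 < y)
    have h1 : (x : ℂ) + y ≠ 1 := fun h => hy (by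
      have : x + y = 1 := by exact_mod_cast h
      linarith)
    rw [hL.logDeriv_L h1 (hG.apply_add_ne_zero hy0.le) (hΞ.apply_add_ne_zero hy0.le),
      show 1 - s - 1 = -s by ring, smul_eq_mul]
    simp only [ψ]
    ring
  refine ⟨hconv.congr hae, ?_⟩
  rw [← integral_congr_ae hae]
  have hfin := hext (show s ∈ {s : ℂ | 0 < s.re ∧ s.re < 2} from ⟨hs0, by linarith⟩)
  simp only at hfin
  rw [hparts] at hfin
  change _ = _ + _ * mellin ψ (1 - s)
  generalize sin ((Real.pi : ℂ) * s) / (Real.pi : ℂ) = c at hfin ⊢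
  field_simp
  linear_combination hfin

end IsPrimaryFunction

theorem mainTheorem1 (L G Ξ : ℂ → ℂ) (q : ℕ) (hL : IsPrimaryFunction L G Ξ q) :
    ∃ Znontriv Ztriv : ℂ → ℂ → ℂ,
      (∀ x : ℂ, IsEligible Ξ x → IsZetaOverZeros Ξ x (fun s => Znontriv s x)) ∧
      (∀ x : ℂ, IsEligible G x → IsZetaOverZeros G x (fun s => Ztriv s x)) ∧
      (∀ x s : ℂ, x - 1 ∈ slitPlane → IsEligible Ξ x → IsEligible G x → s.re < 1 →
        IntegrableOn (fun y : ℝ => logDeriv L (x + (y : ℂ)) * (y : ℂ) ^ (-s)) (Ioi 0) ∧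
        Znontriv s x = -Ztriv s x + (q : ℂ) * (x - 1) ^ (-s)
          + sin ((Real.pi : ℂ) * s) / (Real.pi : ℂ)
            * ∫ y in Ioi (0 : ℝ), logDeriv L (x + (y : ℂ)) * (y : ℂ) ^ (-s)) ∧
      (∀ (x : ℝ) (s : ℂ), 0 < x → 0 < s.re → s.re < 1 →
        IsEligible Ξ (x : ℂ) ∧ IsEligible G (x : ℂ) ∧
        IntegrableOn (fun y : ℝ =>
          (logDeriv L ((x : ℂ) + (y : ℂ)) + (q : ℂ) / ((x : ℂ) + (y : ℂ) - 1))
            * (y : ℂ) ^ (-s)) (Ioi 0) ∧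
        Znontriv s (x : ℂ) = -Ztriv s (x : ℂ)
          + sin ((Real.pi : ℂ) * s) / (Real.pi : ℂ)
            * ∫ y in Ioi (0 : ℝ),
                (logDeriv L ((x : ℂ) + (y : ℂ)) + (q : ℂ) / ((x : ℂ) + (y : ℂ) - 1))
                  * (y : ℂ) ^ (-s)) := by
  have hexΞ : ∀ x : ℂ, ∃ J : ℂ → ℂ, IsEligible Ξ x → IsEntireZeta Ξ x J := fun x => by
    by_cases hx : IsEligible Ξ x
    · obtain ⟨J, hJ⟩ := hL.Xi_order.exists_isEntireZeta hL.Xi_re_le hx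
        (continuousOn_neg_deriv_logDeriv hL.Xi_order.1 hx) (hL.hasInvPowExpansion_Xi x)
      exact ⟨J, fun _ => hJ⟩
    · exact ⟨0, fun h => absurd h hx⟩
  have hexG : ∀ x : ℂ, ∃ K : ℂ → ℂ, IsEligible G x → IsEntireZeta G x K := fun x => by
    by_cases hx : IsEligible G x
    · obtain ⟨K, hK⟩ := hL.G_order.exists_isEntireZeta hL.G_re_le hx
        (continuousOn_neg_deriv_logDeriv hL.G_order.1 hx) (hL.hasInvPowExpansion_G x)
      exact ⟨K, fun _ => hK⟩
    · exact ⟨0, fun h => absurd h hx⟩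
  choose J hJ using hexΞ
  choose K hK using hexG
  refine ⟨fun s x => J x s / (1 - s), fun s x => K x s / (1 - s), fun x hx => ?_, fun x hx => ?_,
    fun x s hx hΞ hG hs => ?_, fun x s hx hs0 hs => ?_⟩
  · exact (hJ x hx).isZetaOverZeros hL.Xi_order hx
  · exact (hK x hx).isZetaOverZeros hL.G_order hx
  · exact hL.zeta_relation hx hΞ hG (hJ x hΞ) (hK x hG) hs
  · have hΞ := hL.isEligible_Xi_ofReal x
    have hG := hL.isEligible_G_of_pos hx
    exact ⟨hΞ, hG, hL.zeta_relation_of_pos hx (hJ x hΞ) (hK x hG) hs0 hs⟩
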